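/- **Setting.** Let $N,T\in\mathbb N$, let all spaces be finite-dimensional Euclidean spaces, let $\Omega_0=\mathcal X_1\times\mathcal W^0_1\times\dots\times\mathcal W^0_T$, and let $\omega_0=(X_1,W^0_1,\dots,W^0_T)$ have independent Gaussian components (arbitrary means, possibly singular covariances). At each time $t=1,\dots,T$, agent $i\in\{1,\dots,N\}$ observes $$y^i_t=h^i_t(\omega_0,u^{1:N}_{1:t-1})+\omega^i_t ,$$ where $h^i_t$ is linear, the $\omega^i_t$ are zero-mean Gaussian with positive-definite covariance, and $\omega_0$ and all the $\omega^i_t$ are independent; here $u^{1:N}_{1:t-1}$, $y^{1:N}_{1:t-1}$ denote the actions and observations of all agents before time $t$. (A linear state recursion is absorbed in $h^i_t$ by substitution.) There is no observation sharing and no recall: a behavioral strategy of agent $i$ at time $t$ is a Markov kernel $\pi^i_t(du^i_t\mid y^i_t)$ from its current observation to its action, and a deterministic strategy is a Borel map $u^i_t=\gamma^i_t(y^i_t)$, identified with the kernel $\delta_{\gamma^i_t(y^i_t)}$. The cost is $$c(\omega_0,y^{1:N}_{1:T},u^{1:N}_{1:T})=\sum_{t=1}^T\sum_{i=1}^N\bigl\|u^i_t-p^i_t(\omega_0,u^{1:N}_{1:t-1},y^{1:N}_{1:t-1},y^i_t)\bigr\|^2_{R^i_t}+\kappa(\omega_0,y^{1:N}_{1:T},u^{1:N}_{1:T}),$$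 with $\|v\|_R^2=v^{\mathsf T}Rv$, each $R^i_t$ positive definite, each $p^i_t$ continuous, and $\kappa\ge 0$ continuous. Let $J(\pi)\in[0,\infty]$ be the expectation of $c$ under the joint law of $(\omega_0,y,u)$ induced by the behavioral strategies $\pi=(\pi^i_t)_{i,t}$. **Theorem.** Every such team admits a team-optimal solution in deterministic strategies: there are deterministic strategies $\gamma=(\gamma^i_t)_{i,t}$ with $J(\gamma)=\inf_{\pi}J(\pi)$, the infimum being over all behavioral strategies. In particular, the following teams admit team-optimal solutions in deterministic strategies. 1. *Vector Witsenhausen counterexample.* $X_1,W_2$ are independent zero-mean Gaussian vectors in $\mathbb R^n$ with positive-definite covariances, $y_1=X_1$, $y_2=u_1+W_2$, and the cost is $\lambda\|u_1-x_1\|^2+\|u_2-u_1\|^2$ with $\lambda>0$. 2. *Multidimensional Gaussian test channel.* $X_1\in\mathbb R^n$ and $W_2\in\mathbb R^m$ are independent zero-mean Gaussian vectors with positive-definite covariances, $y_1=X_1$, $y_2=u_1+W_2$, $u_1\in\mathbb R^m$, $u_2\in\mathbb R^l$, and the cost is $\lambda\|u_1\|^2+\|u_2-Hx_1\|^2$ with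 $\lambda>0$ and $H$ an $l\times n$ matrix. 3. *Gaussian relay channel with $K\ge0$ relays.* All variables lie in $\mathbb R^n$, $X_1$ is Gaussian, $W_1,\dots,W_{K+2}$ are zero-mean Gaussian with positive-definite covariances, all independent, $y_1=X_1+W_1$, $y_j=u_{j-1}+W_j$ for $2\le j\le K+2$, and the cost is $\|u_{K+2}-x_1\|^2+\sum_{j=1}^{K+1}\lambda_j\|u_j\|^2$ with all $\lambda_j>0$. -/

import Mathlib

open MeasureTheory ProbabilityTheory
open scoped ENNReal Matrix

namespace LQG

noncomputable section

/-- The dimensions of the Euclidean spaces of a team with `N` agents acting at `T` times: the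
initial state `X_1`, the plant noises `W^0_t`, and the actions and observations of agent `i` at
time `t`. Times and agents are numbered from `0`. -/
structure TeamDims (N T : ℕ) where
  stateDim : ℕ
  plantNoiseDim : Fin T → ℕ
  actDim : Fin T → Fin N → ℕ
  obsDim : Fin T → Fin N → ℕ

namespace TeamDims

variable {N T : ℕ} (D : TeamDims N T)

/-- `Ω₀ = X_1 × W^0_1 × ⋯ × W^0_T`. -/
abbrev Primitive : Type :=
  EuclideanSpace ℝ (Fin D.stateDim) × ((t : Fin T) → EuclideanSpace ℝ (Fin (D.plantNoiseDim t)))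

/-- The action space of agent `i` at time `t`. -/
abbrev Act (t : Fin T) (i : Fin N) : Type := EuclideanSpace ℝ (Fin (D.actDim t i))

/-- The observation space of agent `i` at time `t`. -/
abbrev Obs (t : Fin T) (i : Fin N) : Type := EuclideanSpace ℝ (Fin (D.obsDim t i))

/-- All actions `u^{1:N}_{1:T}`. -/
abbrev Actions : Type := (t : Fin T) → (i : Fin N) → D.Act t i

/-- All observations `y^{1:N}_{1:T}`. -/
abbrev Observations : Type := (t : Fin T) → (i : Fin N) → D.Obs t i

/-- The actions `u^{1:N}_{1:t-1}` taken strictly before time `t`. -/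
abbrev PastActions (t : Fin T) : Type := (s : {s : Fin T // s < t}) → (i : Fin N) → D.Act s i

/-- The observations `y^{1:N}_{1:t-1}` made strictly before time `t`. -/
abbrev PastObservations (t : Fin T) : Type :=
  (s : {s : Fin T // s < t}) → (i : Fin N) → D.Obs s i

/-- Restriction of an action profile to the times before `t`. -/
def pastActions (t : Fin T) (u : D.Actions) : D.PastActions t := fun s i => u s i

/-- Restriction of an observation profile to the times before `t`. -/
def pastObservations (t : Fin T) (y : D.Observations) : D.PastObservations t := fun s i => y s i

/-- A deterministic strategy of agent `i` at time `t`: a Borel map from its own current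
observation to its action. -/
def DeterministicStrategy (t : Fin T) (i : Fin N) : Type :=
  {γ : D.Obs t i → D.Act t i // Measurable γ}

/-- A behavioral strategy of agent `i` at time `t`: a Markov kernel from its own current
observation to its action. -/
def BehavioralStrategy (t : Fin T) (i : Fin N) : Type :=
  {π : Kernel (D.Obs t i) (D.Act t i) // IsMarkovKernel π}

instance (t : Fin T) (i : Fin N) (π : D.BehavioralStrategy t i) : IsMarkovKernel π.1 := π.2

variable {D} in
/-- The behavioral strategy `y ↦ δ_{γ(y)}` induced by a deterministic strategy. -/
def DeterministicStrategy.toBehavioral {t : Fin T} {i : Fin N}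
    (γ : D.DeterministicStrategy t i) : D.BehavioralStrategy t i :=
  ⟨Kernel.deterministic γ.1 γ.2, inferInstance⟩

end TeamDims

/-- `‖v‖_R² = vᵀ R v`. -/
def quadForm {m : ℕ} (R : Matrix (Fin m) (Fin m) ℝ) (v : EuclideanSpace ℝ (Fin m)) : ℝ :=
  v.ofLp ⬝ᵥ (R *ᵥ v.ofLp)

/-- A dynamic LQG team with no observation sharing. The primitive random variables
`X_1`, `W^0_t` and `ω^i_t` are independent; the joint law they and the strategies
generate is `LQGTeam.law` below. -/
structure LQGTeam {N T : ℕ} (D : TeamDims N T) where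
  /-- law of the initial state -/
  initLaw : Measure (EuclideanSpace ℝ (Fin D.stateDim))
  initLaw_gaussian : IsGaussian initLaw
  /-- laws of the plant noises -/
  plantLaw : (t : Fin T) → Measure (EuclideanSpace ℝ (Fin (D.plantNoiseDim t)))
  plantLaw_gaussian : ∀ t, IsGaussian (plantLaw t)
  /-- covariances of the (centred Gaussian) observation noises `ω^i_t` -/
  noiseCov : (t : Fin T) → (i : Fin N) → Matrix (Fin (D.obsDim t i)) (Fin (D.obsDim t i)) ℝ
  noiseCov_posDef : ∀ t i, (noiseCov t i).PosDef
  /-- `y^i_t = h^i_t(ω₀, u^{1:N}_{1:t-1}) + ω^i_t` with `h^i_t` linear -/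
  h : (t : Fin T) → (i : Fin N) → (D.Primitive × D.PastActions t →ₗ[ℝ] D.Obs t i)
  /-- the cost function -/
  cost : D.Primitive → D.Observations → D.Actions → ℝ
  R : (t : Fin T) → (i : Fin N) → Matrix (Fin (D.actDim t i)) (Fin (D.actDim t i)) ℝ
  R_posDef : ∀ t i, (R t i).PosDef
  p : (t : Fin T) → (i : Fin N) →
    D.Primitive × D.PastActions t × D.PastObservations t × D.Obs t i → D.Act t i
  p_continuous : ∀ t i, Continuous (p t i)
  κ : D.Primitive × D.Observations × D.Actions → ℝ
  κ_nonneg : ∀ x, 0 ≤ κ x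
  κ_continuous : Continuous κ
  cost_eq : ∀ ω y u, cost ω y u =
    (∑ t, ∑ i, quadForm (R t i)
      (u t i - p t i (ω, D.pastActions t u, D.pastObservations t y, y t i))) + κ (ω, y, u)

/-- The product of finitely many Markov kernels with the same source: given the source point, the
coordinates are independent. -/
def piKernel {α : Type*} [MeasurableSpace α] {N : ℕ} {β : Fin N → Type*}
    [∀ i, MeasurableSpace (β i)] (κ : (i : Fin N) → Kernel α (β i)) [∀ i, IsMarkovKernel (κ i)] :
    Kernel α ((i : Fin N) → β i) where
  toFun a := Measure.pi fun i => κ i a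
  measurable' := by
    refine Measurable.measure_of_isPiSystem_of_isProbabilityMeasure
      generateFrom_pi.symm isPiSystem_pi ?_
    rintro _ ⟨s, hs, rfl⟩
    simp only [Measure.pi_pi]
    exact Finset.measurable_prod _ fun i _ =>
      Kernel.measurable_coe (κ i) (hs i (Set.mem_univ i))

instance {α : Type*} [MeasurableSpace α] {N : ℕ} {β : Fin N → Type*}
    [∀ i, MeasurableSpace (β i)] (κ : (i : Fin N) → Kernel α (β i)) [∀ i, IsMarkovKernel (κ i)] :
    IsMarkovKernel (piKernel κ) :=
  ⟨fun a => inferInstanceAs (IsProbabilityMeasure (Measure.pi fun i => κ i a))⟩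

namespace LQGTeam

variable {N T : ℕ} {D : TeamDims N T} (P : LQGTeam D)

instance : IsGaussian P.initLaw := P.initLaw_gaussian

instance (t : Fin T) : IsGaussian (P.plantLaw t) := P.plantLaw_gaussian t

/-- The law of `ω₀ = (X_1, W^0_1, …, W^0_T)`. -/
def primitiveLaw : Measure D.Primitive := P.initLaw.prod (Measure.pi P.plantLaw)

instance : IsProbabilityMeasure P.primitiveLaw :=
  inferInstanceAs (IsProbabilityMeasure (P.initLaw.prod (Measure.pi P.plantLaw)))

/-- The law of the observation noise `ω^i_t`. -/
def noiseLaw (t : Fin T) (i : Fin N) : Measure (D.Obs t i) :=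
  multivariateGaussian 0 (P.noiseCov t i)

instance (t : Fin T) (i : Fin N) : IsProbabilityMeasure (P.noiseLaw t i) :=
  inferInstanceAs (IsProbabilityMeasure (multivariateGaussian 0 (P.noiseCov t i)))

lemma measurable_h (t : Fin T) (i : Fin N) : Measurable (P.h t i) :=
  (LinearMap.continuous_of_finiteDimensional (P.h t i)).measurable

/-- The conditional law of `y^i_t = h^i_t(ω₀, u_{1:t-1}) + ω^i_t` given `(ω₀, u_{1:t-1})`. -/
def obsKernel (t : Fin T) (i : Fin N) : Kernel (D.Primitive × D.PastActions t) (D.Obs t i) where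
  toFun a := (P.noiseLaw t i).map fun w => P.h t i a + w
  measurable' := by
    refine Measure.measurable_of_measurable_coe _ fun s hs => ?_
    have hf : Measurable fun q : (D.Primitive × D.PastActions t) × D.Obs t i =>
        P.h t i q.1 + q.2 := ((P.measurable_h t i).comp measurable_fst).add measurable_snd
    have hm := measurable_measure_prodMk_left (ν := P.noiseLaw t i) (hf hs)
    convert hm using 2 with a
    rw [Measure.map_apply (measurable_const_add _) hs]
    rfl

instance (t : Fin T) (i : Fin N) : IsMarkovKernel (P.obsKernel t i) :=
  ⟨fun _ => Measure.isProbabilityMeasure_map (measurable_const_add _).aemeasurable⟩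

/-- The conditional law of `(y^i_t, u^i_t)` given `(ω₀, u_{1:t-1})`: the observation is drawn from
`obsKernel`, and then the action from the strategy given that observation alone. -/
def agentKernel (π : (t : Fin T) → (i : Fin N) → D.BehavioralStrategy t i) (t : Fin T)
    (i : Fin N) : Kernel (D.Primitive × D.PastActions t) (D.Obs t i × D.Act t i) :=
  P.obsKernel t i ⊗ₖ Kernel.prodMkLeft (D.Primitive × D.PastActions t) (π t i).1

instance (π : (t : Fin T) → (i : Fin N) → D.BehavioralStrategy t i) (t : Fin T) (i : Fin N) :
    IsMarkovKernel (P.agentKernel π t i) :=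
  inferInstanceAs (IsMarkovKernel
    (P.obsKernel t i ⊗ₖ Kernel.prodMkLeft (D.Primitive × D.PastActions t) (π t i).1))

/-- Enter the observations and actions made at time `t` into the trajectory `(ω₀, y, u)`. -/
def record (t : Fin T)
    (q : (D.Primitive × D.Observations × D.Actions) × ((i : Fin N) → D.Obs t i × D.Act t i)) :
    D.Primitive × D.Observations × D.Actions :=
  (q.1.1, Function.update q.1.2.1 t (fun i => (q.2 i).1),
    Function.update q.1.2.2 t (fun i => (q.2 i).2))

lemma measurable_record (t : Fin T) : Measurable (record (D := D) t) := by
  unfold record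
  have hu : ∀ {β : Fin T → Type} [∀ t, MeasurableSpace (β t)],
      Measurable fun r : ((t : Fin T) → β t) × β t => Function.update r.1 t r.2 := by
    intro β _
    refine measurable_pi_lambda _ fun s => ?_
    by_cases hs : s = t
    · subst hs; simpa using measurable_snd
    · simp only [Function.update_of_ne hs]
      fun_prop
  refine (measurable_fst.comp measurable_fst).prodMk ((hu.comp (.prodMk ?_ ?_)).prodMk
    (hu.comp (.prodMk ?_ ?_)))
  all_goals fun_prop

lemma measurable_source (t : Fin T) : Measurable
    fun s : D.Primitive × D.Observations × D.Actions => (s.1, D.pastActions t s.2.2) := by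
  unfold TeamDims.pastActions
  fun_prop

/-- One time step: given the trajectory so far, all agents observe and act at time `t`,
conditionally independently given `(ω₀, u_{1:t-1})`. -/
def stepKernel (π : (t : Fin T) → (i : Fin N) → D.BehavioralStrategy t i) (t : Fin T) :
    Kernel (D.Primitive × D.Observations × D.Actions)
      (D.Primitive × D.Observations × D.Actions) :=
  (Kernel.id ×ₖ (piKernel (P.agentKernel π t)).comap _ (measurable_source t)).map (record t)

instance (π : (t : Fin T) → (i : Fin N) → D.BehavioralStrategy t i) (t : Fin T) :
    IsMarkovKernel (P.stepKernel π t) :=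
  Kernel.IsMarkovKernel.map _ (measurable_record t)

/-- The law of `ω₀` and of the observations and actions made in the first `k` time steps; the
entries that belong to later times are still `0`. -/
def lawUpTo (π : (t : Fin T) → (i : Fin N) → D.BehavioralStrategy t i) :
    (k : ℕ) → k ≤ T → Measure (D.Primitive × D.Observations × D.Actions)
  | 0, _ => P.primitiveLaw.map fun ω => (ω, 0, 0)
  | k + 1, hk => (lawUpTo π k (Nat.le_of_succ_le hk)).bind (P.stepKernel π ⟨k, hk⟩)

/-- The joint law of `(ω₀, y^{1:N}_{1:T}, u^{1:N}_{1:T})` induced by the strategies `π`. -/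
def law (π : (t : Fin T) → (i : Fin N) → D.BehavioralStrategy t i) :
    Measure (D.Primitive × D.Observations × D.Actions) :=
  P.lawUpTo π T le_rfl

/-- The expected cost, in `[0, ∞]`. -/
def expectedCost (π : (t : Fin T) → (i : Fin N) → D.BehavioralStrategy t i) : ℝ≥0∞ :=
  ∫⁻ s, ENNReal.ofReal (P.cost s.1 s.2.1 s.2.2) ∂(P.law π)

/-- `π` attains the infimum of the expected cost over all behavioral strategies. -/
def IsTeamOptimal (π : (t : Fin T) → (i : Fin N) → D.BehavioralStrategy t i) : Prop :=
  P.expectedCost π = ⨅ π' : (t : Fin T) → (i : Fin N) → D.BehavioralStrategy t i,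
    P.expectedCost π'

/-- The team has a team-optimal solution in deterministic strategies. -/
def AdmitsDeterministicTeamOptimum : Prop :=
  ∃ γ : (t : Fin T) → (i : Fin N) → D.DeterministicStrategy t i,
    P.IsTeamOptimal fun t i => (γ t i).toBehavioral

end LQGTeam

lemma quadForm_one {m : ℕ} (v : EuclideanSpace ℝ (Fin m)) : quadForm 1 v = ‖v‖ ^ 2 := by
  rw [EuclideanSpace.real_norm_sq_eq]
  simp [quadForm, dotProduct, sq]

lemma quadForm_smul_one {m : ℕ} (c : ℝ) (v : EuclideanSpace ℝ (Fin m)) :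
    quadForm (c • (1 : Matrix (Fin m) (Fin m) ℝ)) v = c * ‖v‖ ^ 2 := by
  rw [← quadForm_one]
  simp [quadForm, Matrix.smul_mulVec]

lemma posDef_smul_one {m : ℕ} {c : ℝ} (hc : 0 < c) :
    (c • (1 : Matrix (Fin m) (Fin m) ℝ)).PosDef :=
  Matrix.PosDef.one.smul hc

/-- The law of a constant random vector: a Gaussian measure, here on the one-point space. -/
abbrev trivialLaw : Measure (EuclideanSpace ℝ (Fin 0)) := Measure.dirac 0

/-- Spaces of a two-stage problem in which one decision is made at each time: the first observation
lies in `ℝⁿ`, the first action and the second observation in `ℝᵐ`, the second action in `ℝˡ`. -/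
abbrev twoStageDims (n m l : ℕ) : TeamDims 1 2 where
  stateDim := 0
  plantNoiseDim _ := 0
  actDim t _ := match t with
    | 0 => m
    | 1 => l
  obsDim t _ := match t with
    | 0 => n
    | 1 => m

/-- The observations `y_1 = X_1` and `y_2 = u_1 + W_2`; the source `X_1` plays the role of the
observation noise at the first stage. -/
def twoStageObs (n m l : ℕ) : (t : Fin 2) → (i : Fin 1) →
    ((twoStageDims n m l).Primitive × (twoStageDims n m l).PastActions t →ₗ[ℝ]
      (twoStageDims n m l).Obs t i)
  | 0, _ => 0
  | 1, _ =>
    { toFun := fun a => a.2 ⟨0, by decide⟩ 0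
      map_add' := fun _ _ => rfl
      map_smul' := fun _ _ => rfl }

/-- The noise covariances of `twoStageObs`: those of `X_1` and of `W_2`. -/
def twoStageCov {n m l : ℕ} (SX : Matrix (Fin n) (Fin n) ℝ) (SW : Matrix (Fin m) (Fin m) ℝ) :
    (t : Fin 2) → (i : Fin 1) → Matrix (Fin ((twoStageDims n m l).obsDim t i))
      (Fin ((twoStageDims n m l).obsDim t i)) ℝ
  | 0, _ => SX
  | 1, _ => SW

lemma twoStageCov_posDef {n m l : ℕ} {SX : Matrix (Fin n) (Fin n) ℝ}
    {SW : Matrix (Fin m) (Fin m) ℝ} (hX : SX.PosDef) (hW : SW.PosDef) :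
    ∀ t i, (twoStageCov (l := l) SX SW t i).PosDef
  | 0, _ => hX
  | 1, _ => hW

/-- Quadratic weights `lam • 1` on the first action and `1` on the second one. -/
def twoStageWeight (n m l : ℕ) (lam : ℝ) :
    (t : Fin 2) → (i : Fin 1) → Matrix (Fin ((twoStageDims n m l).actDim t i))
      (Fin ((twoStageDims n m l).actDim t i)) ℝ
  | 0, _ => lam • (1 : Matrix (Fin m) (Fin m) ℝ)
  | 1, _ => (1 : Matrix (Fin l) (Fin l) ℝ)

lemma twoStageWeight_posDef {n m l : ℕ} {lam : ℝ} (hlam : 0 < lam) :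
    ∀ t i, (twoStageWeight n m l lam t i).PosDef
  | 0, _ => posDef_smul_one (m := m) hlam
  | 1, _ => Matrix.PosDef.one (n := Fin l)

/-- The vector version of Witsenhausen's counterexample: `X_1 ∼ N(0, SX)` and `W_2 ∼ N(0, SW)` are
independent in `ℝⁿ`, agent 1 observes `X_1` and chooses `u_1`, agent 2 observes `u_1 + W_2` and
chooses `u_2`, and the cost is `lam ‖u_1 - x_1‖² + ‖u_2 - u_1‖²`. -/
def vectorWitsenhausen (n : ℕ) (SX SW : Matrix (Fin n) (Fin n) ℝ) (hX : SX.PosDef)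
    (hW : SW.PosDef) (lam : ℝ) (hlam : 0 < lam) : LQGTeam (twoStageDims n n n) where
  initLaw := trivialLaw
  initLaw_gaussian := inferInstance
  plantLaw _ := trivialLaw
  plantLaw_gaussian _ := inferInstance
  noiseCov := twoStageCov SX SW
  noiseCov_posDef := twoStageCov_posDef hX hW
  h := twoStageObs n n n
  cost _ y u :=
    let x₁ : EuclideanSpace ℝ (Fin n) := y 0 0
    let u₁ : EuclideanSpace ℝ (Fin n) := u 0 0
    let u₂ : EuclideanSpace ℝ (Fin n) := u 1 0
    lam * ‖u₁ - x₁‖ ^ 2 + ‖u₂ - u₁‖ ^ 2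
  R := twoStageWeight n n n lam
  R_posDef := twoStageWeight_posDef hlam
  p
    | 0, 0 => fun a => a.2.2.2
    | 1, 0 => fun a => a.2.1 ⟨0, by decide⟩ 0
  p_continuous
    | 0, 0 => by fun_prop
    | 1, 0 => by fun_prop
  κ _ := 0
  κ_nonneg _ := le_rfl
  κ_continuous := continuous_const
  cost_eq ω y u := by
    simp only [Fin.sum_univ_two, Fin.sum_univ_one, add_zero, Fin.isValue]
    exact congrArg₂ (· + ·) (quadForm_smul_one (m := n) lam _).symm (quadForm_one (m := n) _).symm

/-- The multidimensional Gaussian test channel: `X_1 ∼ N(0, SX)` in `ℝⁿ` and `W_2 ∼ N(0, SW)` in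
`ℝᵐ` are independent, the encoder observes `X_1` and sends `u_1 ∈ ℝᵐ`, the decoder observes
`u_1 + W_2` and chooses `u_2 ∈ ℝˡ`, and the cost is `lam ‖u_1‖² + ‖u_2 - H x_1‖²`. -/
def gaussianTestChannel (n m l : ℕ) (SX : Matrix (Fin n) (Fin n) ℝ)
    (SW : Matrix (Fin m) (Fin m) ℝ) (hX : SX.PosDef) (hW : SW.PosDef)
    (H : Matrix (Fin l) (Fin n) ℝ) (lam : ℝ) (hlam : 0 < lam) :
    LQGTeam (twoStageDims n m l) where
  initLaw := trivialLaw
  initLaw_gaussian := inferInstance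
  plantLaw _ := trivialLaw
  plantLaw_gaussian _ := inferInstance
  noiseCov := twoStageCov SX SW
  noiseCov_posDef := twoStageCov_posDef hX hW
  h := twoStageObs n m l
  cost _ y u :=
    let x₁ : EuclideanSpace ℝ (Fin n) := y 0 0
    let u₁ : EuclideanSpace ℝ (Fin m) := u 0 0
    let u₂ : EuclideanSpace ℝ (Fin l) := u 1 0
    lam * ‖u₁‖ ^ 2 + ‖u₂ - H.toEuclideanLin x₁‖ ^ 2
  R := twoStageWeight n m l lam
  R_posDef := twoStageWeight_posDef hlam
  p
    | 0, 0 => fun _ => 0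
    | 1, 0 => fun a => H.toEuclideanLin (a.2.2.1 ⟨0, by decide⟩ 0)
  p_continuous
    | 0, 0 => continuous_const
    | 1, 0 => (LinearMap.continuous_of_finiteDimensional _).comp (by fun_prop)
  κ _ := 0
  κ_nonneg _ := le_rfl
  κ_continuous := continuous_const
  cost_eq ω y u := by
    simp only [Fin.sum_univ_two, Fin.sum_univ_one, add_zero, Fin.isValue, sub_zero]
    exact congrArg₂ (· + ·) (quadForm_smul_one (m := m) lam _).symm (quadForm_one (m := l) _).symm

/-- Spaces of the relay channel with `K` relays: all variables lie in `ℝⁿ`, and one of the `K + 2`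
decisions is made at each time. -/
abbrev relayDims (n K : ℕ) : TeamDims 1 (K + 2) where
  stateDim := n
  plantNoiseDim _ := 0
  actDim _ _ := n
  obsDim _ _ := n

/-- The Gaussian relay channel with `K` relays: the encoder observes `Y_1 = X_1 + W_1`, each further
agent observes `Y_j = u_{j-1} + W_j`, where `X_1` is Gaussian and the `W_j ∼ N(0, SW j)` are
independent, and the cost is `‖u_{K+2} - x_1‖² + ∑_{j ≤ K+1} lam_j ‖u_j‖²`. -/
def gaussianRelayChannel (n K : ℕ) (μX : Measure (EuclideanSpace ℝ (Fin n)))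
    (hμX : IsGaussian μX) (SW : Fin (K + 2) → Matrix (Fin n) (Fin n) ℝ)
    (hW : ∀ j, (SW j).PosDef) (lam : Fin (K + 1) → ℝ) (hlam : ∀ j, 0 < lam j) :
    LQGTeam (relayDims n K) where
  initLaw := μX
  initLaw_gaussian := hμX
  plantLaw _ := trivialLaw
  plantLaw_gaussian _ := inferInstance
  noiseCov j _ := SW j
  noiseCov_posDef j _ := hW j
  h j _ :=
    { toFun := fun a =>
        if hj : j = 0 then a.1.1
        else a.2 ⟨⟨j - 1, by omega⟩, Fin.lt_def.2 (by
          have := Fin.val_ne_of_ne hj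
          simp only [Fin.val_zero] at this
          simp only
          omega)⟩ 0
      map_add' := fun a b => by split_ifs <;> rfl
      map_smul' := fun c a => by split_ifs <;> rfl }
  cost ω _ u := ‖u (Fin.last (K + 1)) 0 - ω.1‖ ^ 2 + ∑ j : Fin (K + 1), lam j * ‖u j.castSucc 0‖ ^ 2
  R j _ := Fin.lastCases (motive := fun _ => Matrix (Fin n) (Fin n) ℝ) 1 (fun k => lam k • 1) j
  R_posDef j _ := by
    refine Fin.lastCases ?_ (fun k => ?_) j
    · simpa using Matrix.PosDef.one
    · simpa using posDef_smul_one (hlam k)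
  p j _ := fun a => if j = Fin.last (K + 1) then a.1.1 else 0
  p_continuous j _ := by
    split_ifs
    · fun_prop
    · fun_prop
  κ _ := 0
  κ_nonneg _ := le_rfl
  κ_continuous := continuous_const
  cost_eq ω y u := by
    simp [Fin.sum_univ_castSucc (n := K + 1), quadForm_one, quadForm_smul_one, add_comm,
      (Fin.castSucc_lt_last _).ne]

end

end LQG

/-!
The team is reduced to a static one by a change of measure. As the covariance of `ω^i_t` is positive
definite, the conditional law of `y^i_t` given `(ω₀, u_{1:t-1})` has a positive continuous density
with respect to the law of `ω^i_t` (`map_const_add_multivariateGaussian`). Hence the expected cost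
is the integral of a nonnegative continuous function, the cost times all these densities, against
the product of the law of `ω₀` and of the laws `noiseLaw ⊗ₘ π^i_t` of independent
observation–action pairs (`LQGTeam.expectedCost_eq`). Three facts about this integral give the
theorem.

* As a function of the tuple of laws of the observation–action pairs it is lower semicontinuous for
  weak convergence, because products of laws depend continuously on their factors
  (`LQGTeam.lowerSemicontinuous_reducedExpectedCost`).
* The tuples of laws arising from strategies with bounded cost are tight
  (`LQGTeam.exists_isCompact_refLaw_compl_le`). This goes by induction on time: if the pairs before
  time `t` are tight, then with probability bounded below the past stays in a compact set, on which
  the densities are bounded below and `p^i_t` is bounded, and so a large `u^i_t` is costly. By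
  Prokhorov's theorem the closure of this set of tuples is compact. The observation marginals pass
  to the limit, so by disintegration a limit comes from behavioral strategies again, and the
  infimum is attained (`LQGTeam.exists_forall_expectedCost_le`).
* It is affine in each law separately. A behavioral strategy is a function of the observation and
  of an independent uniform seed, so the expected cost of a behavioral profile is an average, over
  the seeds, of expected costs of deterministic profiles, and one of these is at least as good
  (`LQGTeam.exists_deterministic_expectedCost_le`). No measurable selection is involved.
-/

namespace LQG

noncomputable section

/-! ### Densities of shifted Gaussian measures -/

lemma map_withDensity_comp {α β : Type*} [MeasurableSpace α] [MeasurableSpace β]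
    (μ : Measure α) {g : α → β} (hg : Measurable g) {f : β → ℝ≥0∞} (hf : Measurable f) :
    (μ.withDensity fun x => f (g x)).map g = (μ.map g).withDensity f := by
  ext s hs
  rw [Measure.map_apply hg hs, withDensity_apply _ (hg hs), withDensity_apply _ hs,
    setLIntegral_map hs hf hg]

lemma lintegral_prod_eval_pi {ι : Type*} [Fintype ι] {X : ι → Type*}
    [∀ i, MeasurableSpace (X i)] (μ : (i : ι) → Measure (X i)) [∀ i, IsProbabilityMeasure (μ i)]
    {f : (i : ι) → X i → ℝ≥0∞} (hf : ∀ i, Measurable (f i)) :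
    ∫⁻ x, ∏ i, f i (x i) ∂Measure.pi μ = ∏ i, ∫⁻ x, f i x ∂μ i := by
  have hind := iIndepFun_pi (μ := μ) (X := f) fun i => (hf i).aemeasurable
  rw [lintegral_prod_eq_prod_lintegral_of_indepFun Finset.univ _ hind
    fun i => (hf i).comp (measurable_pi_apply i)]
  refine Finset.prod_congr rfl fun i _ => ?_
  exact (measurePreserving_eval μ i).lintegral_comp (hf i)

lemma pi_withDensity {ι : Type*} [Fintype ι] {X : ι → Type*} [∀ i, MeasurableSpace (X i)]
    (μ : (i : ι) → Measure (X i)) [∀ i, IsProbabilityMeasure (μ i)]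
    {f : (i : ι) → X i → ℝ≥0∞} (hf : ∀ i, Measurable (f i))
    [∀ i, SigmaFinite ((μ i).withDensity (f i))] :
    Measure.pi (fun i => (μ i).withDensity (f i)) =
      (Measure.pi μ).withDensity fun x => ∏ i, f i (x i) := by
  refine Measure.pi_eq fun s hs => ?_
  rw [withDensity_apply _ (MeasurableSet.univ_pi hs),
    ← lintegral_indicator (MeasurableSet.univ_pi hs)]
  have h : (Set.univ.pi s).indicator (fun x => ∏ i, f i (x i)) =
      fun x => ∏ i, (s i).indicator (f i) (x i) := by
    ext x
    by_cases hx : x ∈ Set.univ.pi s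
    · rw [Set.indicator_of_mem hx]
      exact Finset.prod_congr rfl fun i _ => (Set.indicator_of_mem (hx i trivial) _).symm
    · rw [Set.indicator_of_notMem hx]
      simp only [Set.mem_univ_pi, not_forall] at hx
      obtain ⟨i, hi⟩ := hx
      exact (Finset.prod_eq_zero (Finset.mem_univ i) (Set.indicator_of_notMem hi _)).symm
  rw [h, lintegral_prod_eval_pi μ fun i => (hf i).indicator (hs i)]
  exact Finset.prod_congr rfl fun i _ => by
    rw [withDensity_apply _ (hs i), lintegral_indicator (hs i)]

lemma gaussianReal_zero_one_withDensity (m : ℝ) :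
    (gaussianReal 0 1).withDensity (fun x => ENNReal.ofReal (Real.exp (m * x - m * m / 2))) =
      gaussianReal m 1 := by
  rw [gaussianReal_of_var_ne_zero _ one_ne_zero, gaussianReal_of_var_ne_zero _ one_ne_zero,
    ← withDensity_mul _ (measurable_gaussianPDF 0 1) (by fun_prop)]
  congr 1
  ext x
  simp only [Pi.mul_apply, gaussianPDF, gaussianPDFReal]
  rw [← ENNReal.ofReal_mul (by positivity), mul_assoc, ← Real.exp_add]
  congr 3
  push_cast
  ring

lemma map_const_add_pi_gaussianReal {ι : Type*} [Fintype ι] (w : ι → ℝ) :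
    (Measure.pi fun _ : ι => gaussianReal 0 1).map (fun x => w + x) =
      (Measure.pi fun _ : ι => gaussianReal 0 1).withDensity
        fun x => ENNReal.ofReal (Real.exp (w ⬝ᵥ x - w ⬝ᵥ w / 2)) := by
  have h1 : (Measure.pi fun _ : ι => gaussianReal 0 1).map (fun x => w + x) =
      Measure.pi fun i => gaussianReal (w i) 1 := by
    have := Measure.pi_map_pi (μ := fun _ : ι => gaussianReal 0 1) (f := fun i x => w i + x)
      fun i => by fun_prop
    refine Eq.trans this ?_
    congr 1
    ext1 i
    rw [gaussianReal_map_const_add, zero_add]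
  have h2 (i : ι) : SigmaFinite ((gaussianReal 0 1).withDensity
      fun x => ENNReal.ofReal (Real.exp (w i * x - w i * w i / 2))) := by
    rw [gaussianReal_zero_one_withDensity]; infer_instance
  rw [h1]
  rw [show (fun i => gaussianReal (w i) 1) = fun i => (gaussianReal 0 1).withDensity
    (fun x => ENNReal.ofReal (Real.exp (w i * x - w i * w i / 2))) from
    funext fun i => (gaussianReal_zero_one_withDensity (w i)).symm]
  rw [pi_withDensity _ (fun i => by fun_prop)]
  congr 1
  ext x
  rw [← ENNReal.ofReal_prod_of_nonneg fun i _ => (Real.exp_pos _).le, ← Real.exp_sum,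
    Finset.sum_sub_distrib, ← Finset.sum_div]
  rfl

/-- The density of `N(v, S)` with respect to `N(0, S)`, for `S` positive definite. -/
def gaussianShiftDensity {ι : Type*} [Fintype ι] [DecidableEq ι] (S : Matrix ι ι ℝ)
    (v y : EuclideanSpace ℝ ι) : ℝ :=
  Real.exp (v.ofLp ⬝ᵥ (S⁻¹ *ᵥ y.ofLp) - v.ofLp ⬝ᵥ (S⁻¹ *ᵥ v.ofLp) / 2)

lemma gaussianShiftDensity_pos {ι : Type*} [Fintype ι] [DecidableEq ι] (S : Matrix ι ι ℝ)
    (v y : EuclideanSpace ℝ ι) : 0 < gaussianShiftDensity S v y :=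
  Real.exp_pos _

lemma continuous_gaussianShiftDensity {ι : Type*} [Fintype ι] [DecidableEq ι]
    (S : Matrix ι ι ℝ) :
    Continuous fun q : EuclideanSpace ℝ ι × EuclideanSpace ℝ ι =>
      gaussianShiftDensity S q.1 q.2 := by
  unfold gaussianShiftDensity dotProduct Matrix.mulVec dotProduct
  fun_prop

open scoped MatrixOrder in
/-- The symmetric square root of a positive definite matrix is invertible. -/
lemma exists_sqrt_of_posDef {ι : Type*} [Fintype ι] [DecidableEq ι]
    {S : Matrix ι ι ℝ} (hS : S.PosDef) :
    ∃ A : Matrix ι ι ℝ, A = CFC.sqrt S ∧ Aᵀ = A ∧ A * A = S ∧ IsUnit A.det := by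
  have hAA : CFC.sqrt S * CFC.sqrt S = S := CFC.sqrt_mul_sqrt_self S hS.posSemidef.nonneg
  have hAT : IsSelfAdjoint (CFC.sqrt S) := (CFC.sqrt_nonneg S).isSelfAdjoint
  refine ⟨CFC.sqrt S, rfl, ?_, hAA, ?_⟩
  · simpa [IsSelfAdjoint, Matrix.star_eq_conjTranspose] using hAT
  · have : IsUnit (CFC.sqrt S * CFC.sqrt S).det := by
      rw [hAA]; exact (Matrix.isUnit_iff_isUnit_det _).1 hS.isUnit
    rw [Matrix.det_mul] at this
    exact isUnit_of_mul_isUnit_left this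

/-- The Cameron–Martin formula in finite dimension: writing `N(0, S)` as the image of the standard
Gaussian measure under `√S`, a shift by `v` is the image of a shift by `√S⁻¹ v`, and the latter
can be computed coordinatewise. -/
lemma map_const_add_multivariateGaussian {ι : Type*} [Fintype ι] [DecidableEq ι]
    {S : Matrix ι ι ℝ} (hS : S.PosDef) (v : EuclideanSpace ℝ ι) :
    (multivariateGaussian 0 S).map (fun x => v + x) =
      (multivariateGaussian 0 S).withDensity
        fun y => ENNReal.ofReal (gaussianShiftDensity S v y) := by
  obtain ⟨A, hA, hAT, hAA, hdet⟩ := exists_sqrt_of_posDef hS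
  have hSinv : S⁻¹ = A⁻¹ * A⁻¹ := by rw [← hAA, Matrix.mul_inv_rev]
  have hATinv : A⁻¹ᵀ = A⁻¹ := by rw [Matrix.transpose_nonsing_inv, hAT]
  obtain ⟨B, hBdef⟩ : ∃ B : (ι → ℝ) → EuclideanSpace ℝ ι, B = fun x => WithLp.toLp 2 (A *ᵥ x) :=
    ⟨_, rfl⟩
  have hB : Measurable B := by
    rw [hBdef]
    refine Continuous.measurable ?_
    unfold Matrix.mulVec dotProduct
    fun_prop
  have hmap : multivariateGaussian 0 S =
      (Measure.pi fun _ : ι => gaussianReal 0 1).map B := by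
    rw [multivariateGaussian, ← map_pi_eq_stdGaussian, Measure.map_map (by fun_prop) (by fun_prop)]
    congr 1
    ext x i
    simp [hBdef, hA, Matrix.toEuclideanCLM_toLp]
  set w : ι → ℝ := A⁻¹ *ᵥ v.ofLp with hw
  have hBw : (fun x => v + x) ∘ B = B ∘ fun x => w + x := by
    ext x i
    simp [hBdef, hw, Matrix.mulVec_add, Matrix.mulVec_mulVec, Matrix.mul_nonsing_inv _ hdet]
  have hdens (x : ι → ℝ) : Real.exp (w ⬝ᵥ x - w ⬝ᵥ w / 2) = gaussianShiftDensity S v (B x) := by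
    unfold gaussianShiftDensity
    have h1 : S⁻¹ *ᵥ (B x).ofLp = A⁻¹ *ᵥ x := by
      simp [hBdef, hSinv, Matrix.mulVec_mulVec, Matrix.mul_assoc, Matrix.nonsing_inv_mul _ hdet]
    have h2 (z : ι → ℝ) : w ⬝ᵥ z = v.ofLp ⬝ᵥ (A⁻¹ *ᵥ z) := by
      rw [hw, Matrix.dotProduct_mulVec, ← Matrix.mulVec_transpose, hATinv]
    rw [h1, h2, h2, hw, hSinv, Matrix.mulVec_mulVec]
  rw [hmap, Measure.map_map (measurable_const_add v) hB, hBw,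
    ← Measure.map_map hB (measurable_const_add w), map_const_add_pi_gaussianReal]
  simp only [hdens]
  have hm : Measurable fun y => ENNReal.ofReal (gaussianShiftDensity S v y) := by
    have := (continuous_gaussianShiftDensity S).comp
      (continuous_const.prodMk continuous_id : Continuous fun y => (v, y))
    exact this.measurable.ennreal_ofReal
  rw [map_withDensity_comp (Measure.pi fun _ : ι => gaussianReal 0 1) hB hm]

/-! ### Static reduction -/

namespace TeamDims

variable {N T : ℕ} (D : TeamDims N T)

/-- All observation–action pairs of a team, the variables that become independent under the
reference measure. -/
abbrev Records : Type := (t : Fin T) → (i : Fin N) → D.Obs t i × D.Act t i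

variable {D}

/-- The trajectory `(ω₀, y, u)` with given observation–action pairs. -/
def trajectory (q : D.Primitive × D.Records) : D.Primitive × D.Observations × D.Actions :=
  (q.1, fun t i => (q.2 t i).1, fun t i => (q.2 t i).2)

lemma continuous_trajectory : Continuous (trajectory (D := D)) := by
  unfold trajectory
  fun_prop

lemma continuous_trajectory_right (ω : D.Primitive) :
    Continuous fun z : D.Records => trajectory (ω, z) := by
  unfold trajectory
  fun_prop

lemma continuous_pastActions (t : Fin T) : Continuous (D.pastActions t) := by
  unfold pastActions
  fun_prop

lemma continuous_pastObservations (t : Fin T) : Continuous (D.pastObservations t) := by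
  unfold pastObservations
  fun_prop

lemma pastActions_congr {t : Fin T} {u u' : D.Actions} (h : ∀ s < t, u s = u' s) :
    D.pastActions t u = D.pastActions t u' :=
  funext fun s => h s s.2

lemma pastObservations_congr {t : Fin T} {y y' : D.Observations} (h : ∀ s < t, y s = y' s) :
    D.pastObservations t y = D.pastObservations t y' :=
  funext fun s => h s s.2

end TeamDims

open TeamDims

/-- The finite set of times before `k`. -/
def timesBefore (T k : ℕ) : Finset (Fin T) := Finset.univ.filter fun t => t.1 < k

@[simp] lemma mem_timesBefore {T k : ℕ} {t : Fin T} : t ∈ timesBefore T k ↔ t.1 < k := by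
  simp [timesBefore]

lemma timesBefore_zero (T : ℕ) : timesBefore T 0 = ∅ := by
  ext; simp

lemma timesBefore_succ {T k : ℕ} (hk : k < T) :
    timesBefore T (k + 1) = insert ⟨k, hk⟩ (timesBefore T k) := by
  ext t
  simp only [mem_timesBefore, Finset.mem_insert, Fin.ext_iff]
  omega

/-- A marginal integral over all the variables on which `f` depends is the full integral. -/
lemma lmarginal_eq_lintegral_of_dependsOn {ι : Type*} [Fintype ι] [DecidableEq ι] {X : ι → Type*}
    [∀ i, MeasurableSpace (X i)] (μ : (i : ι) → Measure (X i)) [∀ i, IsProbabilityMeasure (μ i)]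
    {s : Finset ι} {f : ((i : ι) → X i) → ℝ≥0∞} (hf : Measurable f)
    (h : ∀ x y, (∀ i ∈ s, x i = y i) → f x = f y) (x : (i : ι) → X i) :
    (∫⋯∫⁻_s, f ∂μ) x = ∫⁻ z, f z ∂Measure.pi μ := by
  have hc : ∫⋯∫⁻_sᶜ, f ∂μ = f := by
    ext z
    have : ∀ y, f (Function.updateFinset z sᶜ y) = f z := fun y => h _ _ fun i hi => by
      simp [Function.updateFinset, hi]
    simp [lmarginal, this]
  rw [lintegral_eq_lmarginal_univ x, ← Finset.union_compl s,
    lmarginal_union μ f hf disjoint_compl_right, hc]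

lemma quadForm_nonneg {m : ℕ} {R : Matrix (Fin m) (Fin m) ℝ} (hR : R.PosDef)
    (v : EuclideanSpace ℝ (Fin m)) : 0 ≤ quadForm R v := by
  simpa [quadForm] using hR.posSemidef.dotProduct_mulVec_nonneg v.ofLp

lemma continuous_quadForm {m : ℕ} (R : Matrix (Fin m) (Fin m) ℝ) : Continuous (quadForm R) := by
  unfold quadForm Matrix.mulVec dotProduct
  fun_prop

/-- A positive definite quadratic form is coercive. -/
lemma exists_pos_mul_sq_norm_le_quadForm {m : ℕ} {R : Matrix (Fin m) (Fin m) ℝ} (hR : R.PosDef) :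
    ∃ c > 0, ∀ v, c * ‖v‖ ^ 2 ≤ quadForm R v := by
  obtain ⟨c, hc, h⟩ := (isCompact_sphere (0 : EuclideanSpace ℝ (Fin m)) 1).exists_forall_le'
    (continuous_quadForm R).continuousOn (a := 0) fun v hv => by
      have hv0 : v.ofLp ≠ 0 := fun h0 => by
        have : v = 0 := by ext j; simp [h0]
        simp [this] at hv
      simpa [quadForm] using hR.dotProduct_mulVec_pos hv0
  refine ⟨c, hc, fun v => ?_⟩
  rcases eq_or_ne v 0 with rfl | hv
  · simp [quadForm]
  have h1 := h (‖v‖⁻¹ • v) (by simp [norm_smul, hv])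
  have h2 : quadForm R (‖v‖⁻¹ • v) = (‖v‖ ^ 2)⁻¹ * quadForm R v := by
    simp only [quadForm, WithLp.ofLp_smul, Matrix.mulVec_smul, dotProduct_smul, smul_dotProduct,
      smul_eq_mul]
    ring
  rw [h2] at h1
  have hpos : 0 < ‖v‖ ^ 2 := by positivity
  calc c * ‖v‖ ^ 2 ≤ (‖v‖ ^ 2)⁻¹ * quadForm R v * ‖v‖ ^ 2 := by gcongr
    _ = quadForm R v := by field_simp

namespace LQGTeam

variable {N T : ℕ} {D : TeamDims N T} (P : LQGTeam D)

/-- The density of the observation `y^i_t` given `(ω₀, u_{1:t-1})` with respect to the law of the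
observation noise `ω^i_t`. -/
def obsDensity (t : Fin T) (i : Fin N) (a : D.Primitive × D.PastActions t) (y : D.Obs t i) : ℝ :=
  gaussianShiftDensity (P.noiseCov t i) (P.h t i a) y

lemma obsDensity_pos (t : Fin T) (i : Fin N) (a : D.Primitive × D.PastActions t)
    (y : D.Obs t i) : 0 < P.obsDensity t i a y :=
  gaussianShiftDensity_pos _ _ _

lemma continuous_obsDensity (t : Fin T) (i : Fin N) :
    Continuous fun q : (D.Primitive × D.PastActions t) × D.Obs t i =>
      P.obsDensity t i q.1 q.2 :=
  (continuous_gaussianShiftDensity (P.noiseCov t i)).comp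
    (((LinearMap.continuous_of_finiteDimensional (P.h t i)).comp continuous_fst).prodMk
      continuous_snd)

lemma measurable_obsDensity (t : Fin T) (i : Fin N) (a : D.Primitive × D.PastActions t) :
    Measurable fun y => ENNReal.ofReal (P.obsDensity t i a y) :=
  ((P.continuous_obsDensity t i).comp (continuous_const.prodMk continuous_id)).measurable
    |>.ennreal_ofReal

lemma obsKernel_apply (t : Fin T) (i : Fin N) (a : D.Primitive × D.PastActions t) :
    P.obsKernel t i a =
      (P.noiseLaw t i).withDensity fun y => ENNReal.ofReal (P.obsDensity t i a y) :=
  map_const_add_multivariateGaussian (P.noiseCov_posDef t i) (P.h t i a)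

/-- The joint law of the observation and the action of agent `i` at time `t` under the reference
measure, that is, when the observation is the pure noise `ω^i_t`. -/
def refLaw (t : Fin T) (i : Fin N) (π : D.BehavioralStrategy t i) :
    Measure (D.Obs t i × D.Act t i) :=
  P.noiseLaw t i ⊗ₘ π.1

instance (t : Fin T) (i : Fin N) (π : D.BehavioralStrategy t i) :
    IsProbabilityMeasure (P.refLaw t i π) :=
  inferInstanceAs (IsProbabilityMeasure (P.noiseLaw t i ⊗ₘ π.1))

lemma agentKernel_apply (π : (t : Fin T) → (i : Fin N) → D.BehavioralStrategy t i) (t : Fin T)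
    (i : Fin N) (a : D.Primitive × D.PastActions t) :
    P.agentKernel π t i a = (P.refLaw t i (π t i)).withDensity
      fun q => ENNReal.ofReal (P.obsDensity t i a q.1) := by
  have hm := P.measurable_obsDensity t i a
  ext s hs
  have hi : Measurable (s.indicator fun q : D.Obs t i × D.Act t i =>
      ENNReal.ofReal (P.obsDensity t i a q.1)) := (hm.comp measurable_fst).indicator hs
  rw [agentKernel, Kernel.compProd_apply hs, withDensity_apply _ hs, refLaw,
    ← lintegral_indicator hs, Measure.lintegral_compProd hi,
    obsKernel_apply, lintegral_withDensity_eq_lintegral_mul _ hm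
      (Kernel.measurable_kernel_prodMk_left' hs a)]
  refine lintegral_congr fun y => ?_
  have : (fun u => s.indicator (fun q : D.Obs t i × D.Act t i =>
      ENNReal.ofReal (P.obsDensity t i a q.1)) (y, u)) =
      (Prod.mk y ⁻¹' s).indicator fun _ => ENNReal.ofReal (P.obsDensity t i a y) := by
    ext u
    by_cases h : (y, u) ∈ s
    · rw [Set.indicator_of_mem h, Set.indicator_of_mem (show u ∈ Prod.mk y ⁻¹' s from h)]
    · rw [Set.indicator_of_notMem h, Set.indicator_of_notMem (show u ∉ Prod.mk y ⁻¹' s from h)]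
  rw [Pi.mul_apply, this, lintegral_indicator_const (measurable_prodMk_left hs)]
  rfl

/-- The joint density of the observations at time `t` given the past. -/
def stageDensity (t : Fin T) (ω : D.Primitive) (z : D.Records) : ℝ :=
  ∏ i, P.obsDensity t i (ω, D.pastActions t fun s j => (z s j).2) (z t i).1

lemma stageDensity_pos (t : Fin T) (ω : D.Primitive) (z : D.Records) :
    0 < P.stageDensity t ω z :=
  Finset.prod_pos fun i _ => P.obsDensity_pos t i _ _

lemma continuous_stageDensity (t : Fin T) :
    Continuous fun q : D.Primitive × D.Records => P.stageDensity t q.1 q.2 := by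
  refine continuous_finsetProd _ fun i _ => (P.continuous_obsDensity t i).comp
    (((continuous_fst).prodMk ((continuous_pastActions t).comp ?_)).prodMk ?_)
  all_goals fun_prop

lemma stageDensity_congr {t : Fin T} (ω : D.Primitive) {z z' : D.Records}
    (h : ∀ s < t, z s = z' s) (ht : ∀ i, (z t i).1 = (z' t i).1) :
    P.stageDensity t ω z = P.stageDensity t ω z' := by
  unfold stageDensity
  rw [pastActions_congr (u := fun s j => (z s j).2) (u' := fun s j => (z' s j).2)
    fun s hs => by simp only [h s hs]]
  simp only [ht]

/-- The joint density of the observations before time `k`. -/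
def density (k : ℕ) (ω : D.Primitive) (z : D.Records) : ℝ :=
  ∏ t ∈ timesBefore T k, P.stageDensity t ω z

lemma density_pos (k : ℕ) (ω : D.Primitive) (z : D.Records) : 0 < P.density k ω z :=
  Finset.prod_pos fun t _ => P.stageDensity_pos t _ _

lemma continuous_density (k : ℕ) :
    Continuous fun q : D.Primitive × D.Records => P.density k q.1 q.2 :=
  continuous_finsetProd _ fun _ _ => P.continuous_stageDensity _

lemma density_congr {k : ℕ} (ω : D.Primitive) {z z' : D.Records}
    (h : ∀ t : Fin T, t.1 < k → z t = z' t) : P.density k ω z = P.density k ω z' :=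
  Finset.prod_congr rfl fun t ht => P.stageDensity_congr ω
    (fun s hs => h s (lt_trans hs (mem_timesBefore.1 ht)))
    fun i => by rw [h t (mem_timesBefore.1 ht)]

lemma density_succ {k : ℕ} (hk : k < T) (ω : D.Primitive) (z : D.Records) :
    P.density (k + 1) ω z = P.stageDensity ⟨k, hk⟩ ω z * P.density k ω z := by
  rw [density, timesBefore_succ hk, Finset.prod_insert (by simp)]
  rfl

variable (π : (t : Fin T) → (i : Fin N) → D.BehavioralStrategy t i)

lemma piKernel_agentKernel_apply (t : Fin T) (a : D.Primitive × D.PastActions t) :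
    piKernel (P.agentKernel π t) a = (Measure.pi fun i => P.refLaw t i (π t i)).withDensity
      fun q => ∏ i, ENNReal.ofReal (P.obsDensity t i a (q i).1) := by
  have hm (i : Fin N) : Measurable fun q : D.Obs t i × D.Act t i =>
      ENNReal.ofReal (P.obsDensity t i a q.1) := (P.measurable_obsDensity t i a).comp measurable_fst
  have (i : Fin N) : SigmaFinite ((P.refLaw t i (π t i)).withDensity
      fun q => ENNReal.ofReal (P.obsDensity t i a q.1)) := by
    rw [← agentKernel_apply]; infer_instance
  rw [← pi_withDensity (fun i => P.refLaw t i (π t i)) hm]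
  simp_rw [← agentKernel_apply]
  rfl

lemma record_trajectory (t : Fin T) (ω : D.Primitive) (z : D.Records)
    (q : (i : Fin N) → D.Obs t i × D.Act t i) :
    record t (trajectory (ω, z), q) = trajectory (ω, Function.update z t q) := by
  unfold record trajectory
  refine Prod.ext rfl (Prod.ext ?_ ?_)
  all_goals
    ext s : 1
    by_cases hs : s = t
    · subst hs; simp
    · simp [Function.update_of_ne hs]

lemma lintegral_stepKernel (t : Fin T) {f : D.Primitive × D.Observations × D.Actions → ℝ≥0∞}
    (hf : Measurable f) (s : D.Primitive × D.Observations × D.Actions) :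
    ∫⁻ x, f x ∂P.stepKernel π t s =
      ∫⁻ q, f (record t (s, q)) ∂piKernel (P.agentKernel π t) (s.1, D.pastActions t s.2.2) := by
  have hr : Measurable fun r => f (record (D := D) t r) := hf.comp (measurable_record t)
  rw [stepKernel, Kernel.map_apply _ (measurable_record t), lintegral_map hf (measurable_record t),
    Kernel.prod_apply, Kernel.id_apply, Kernel.comap_apply, lintegral_prod _ hr.aemeasurable,
    lintegral_dirac' _ hr.lintegral_prod_right']

lemma measurable_stageDensity_mul (t : Fin T) (ω : D.Primitive)
    {f : D.Primitive × D.Observations × D.Actions → ℝ≥0∞} (hf : Measurable f) :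
    Measurable fun z : D.Records =>
      ENNReal.ofReal (P.stageDensity t ω z) * f (trajectory (ω, z)) :=
  Measurable.mul (Continuous.uncurry_left ω (P.continuous_stageDensity t)).measurable.ennreal_ofReal
    (hf.comp (continuous_trajectory_right ω).measurable)

/-- One time step in reference form: the stage-`t` pairs are drawn independently of the past and
weighted by the density of the stage. -/
lemma lintegral_stepKernel_trajectory (t : Fin T)
    {f : D.Primitive × D.Observations × D.Actions → ℝ≥0∞} (hf : Measurable f) (ω : D.Primitive)
    (z : D.Records) :
    ∫⁻ x, f x ∂P.stepKernel π t (trajectory (ω, z)) =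
      ∫⁻ q, ENNReal.ofReal (P.stageDensity t ω (Function.update z t q)) *
        f (trajectory (ω, Function.update z t q)) ∂Measure.pi fun i => P.refLaw t i (π t i) := by
  have hs (q : (i : Fin N) → D.Obs t i × D.Act t i) :
      ENNReal.ofReal (P.stageDensity t ω (Function.update z t q)) =
        ∏ i, ENNReal.ofReal (P.obsDensity t i
          (ω, D.pastActions t fun s j => (z s j).2) (q i).1) := by
    rw [stageDensity, ENNReal.ofReal_prod_of_nonneg fun i _ => (P.obsDensity_pos _ _ _ _).le]
    refine Finset.prod_congr rfl fun i _ => ?_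
    rw [Function.update_self, pastActions_congr
      (u := fun s j => (Function.update z t q s j).2) (u' := fun s j => (z s j).2)
      fun s hs => by simp only [Function.update_of_ne (Fin.ne_of_lt hs)]]
  have h1 : Measurable fun q : (i : Fin N) → D.Obs t i × D.Act t i =>
      ∏ i, ENNReal.ofReal (P.obsDensity t i
        (ω, D.pastActions t fun s j => (z s j).2) (q i).1) :=
    Finset.measurable_fun_prod _ fun i _ =>
      (P.measurable_obsDensity t i _).comp (measurable_fst.comp (measurable_pi_apply i))
  have h2 : Measurable fun q : (i : Fin N) → D.Obs t i × D.Act t i =>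
      f (record t (trajectory (ω, z), q)) :=
    hf.comp ((measurable_record t).comp measurable_prodMk_left)
  have h3 : piKernel (P.agentKernel π t)
      ((trajectory (ω, z)).1, D.pastActions t (trajectory (ω, z)).2.2) =
      (Measure.pi fun i => P.refLaw t i (π t i)).withDensity fun q =>
        ∏ i, ENNReal.ofReal (P.obsDensity t i
          (ω, D.pastActions t fun s j => (z s j).2) (q i).1) :=
    P.piKernel_agentKernel_apply π t _
  rw [lintegral_stepKernel _ _ _ hf, h3, lintegral_withDensity_eq_lintegral_mul _ h1 h2]
  refine lintegral_congr fun q => ?_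
  rw [Pi.mul_apply, hs, record_trajectory]

/-- The reference law of all observation–action pairs: they are independent. -/
def refMeasure : Measure D.Records :=
  Measure.pi fun t => Measure.pi fun i => P.refLaw t i (π t i)

instance : IsProbabilityMeasure (P.refMeasure π) :=
  inferInstanceAs (IsProbabilityMeasure
    (Measure.pi fun t => Measure.pi fun i => P.refLaw t i (π t i)))

lemma measurable_density_mul (k : ℕ) (ω : D.Primitive)
    {f : D.Primitive × D.Observations × D.Actions → ℝ≥0∞} (hf : Measurable f) :
    Measurable fun z : D.Records =>
      ENNReal.ofReal (P.density k ω z) * f (trajectory (ω, z)) :=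
  Measurable.mul (Continuous.uncurry_left ω (P.continuous_density k)).measurable.ennreal_ofReal
    (hf.comp (continuous_trajectory_right ω).measurable)

/-- Under the law of the first `k` stages the observation–action pairs have the density `density k`
with respect to independent pairs. The base point `0` of the marginal integral is the value of the
entries of later stages. -/
lemma lintegral_lawUpTo (k : ℕ) (hk : k ≤ T)
    {f : D.Primitive × D.Observations × D.Actions → ℝ≥0∞} (hf : Measurable f) :
    ∫⁻ x, f x ∂P.lawUpTo π k hk = ∫⁻ ω,
      (∫⋯∫⁻_(timesBefore T k), (fun z => ENNReal.ofReal (P.density k ω z) * f (trajectory (ω, z)))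
        ∂fun t => Measure.pi fun i => P.refLaw t i (π t i)) 0 ∂P.primitiveLaw := by
  induction k generalizing f with
  | zero =>
    rw [lawUpTo, lintegral_map hf (by fun_prop)]
    refine lintegral_congr fun ω => ?_
    simp only [timesBefore_zero, lmarginal_empty, density, Finset.prod_empty, ENNReal.ofReal_one,
      one_mul]
    rfl
  | succ k ih =>
    rw [lawUpTo, Measure.lintegral_bind (P.stepKernel π ⟨k, hk⟩).measurable.aemeasurable
      hf.aemeasurable, ih _ (Measurable.lintegral_kernel hf)]
    refine lintegral_congr fun ω => ?_
    have hm : Measurable fun z =>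
        ENNReal.ofReal (P.density (k + 1) ω z) * f (trajectory (ω, z)) :=
      P.measurable_density_mul (k + 1) ω hf
    have hk' : (⟨k, hk⟩ : Fin T) ∉ timesBefore T k := by simp
    rw [timesBefore_succ hk, lmarginal_insert' _ hm hk']
    congr 1
    ext z
    have hm' : Measurable fun q => ENNReal.ofReal
          (P.stageDensity ⟨k, hk⟩ ω (Function.update z ⟨k, hk⟩ q)) *
        f (trajectory (ω, Function.update z ⟨k, hk⟩ q)) :=
      (P.measurable_stageDensity_mul ⟨k, hk⟩ ω hf).comp (measurable_update z)
    rw [P.lintegral_stepKernel_trajectory π _ hf, ← lintegral_const_mul _ hm']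
    refine lintegral_congr fun q => ?_
    have hd : P.density k ω (Function.update z ⟨k, hk⟩ q) = P.density k ω z :=
      P.density_congr ω fun _ ht => Function.update_of_ne (Fin.ne_of_lt ht) _ _
    rw [density_succ P hk, hd, ENNReal.ofReal_mul (P.stageDensity_pos _ _ _).le]
    ring

/-- If `f` only depends on what happens before time `k`, then its expectation can be computed at
time `k`, and the reference measure may be taken over all times. -/
lemma lintegral_lawUpTo_eq_lintegral_refMeasure (k : ℕ) (hk : k ≤ T)
    {f : D.Primitive × D.Observations × D.Actions → ℝ≥0∞} (hf : Measurable f)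
    (h : ∀ ω (z z' : D.Records), (∀ t : Fin T, t.1 < k → z t = z' t) →
      f (trajectory (ω, z)) = f (trajectory (ω, z'))) :
    ∫⁻ x, f x ∂P.lawUpTo π k hk = ∫⁻ ω, ∫⁻ z,
      ENNReal.ofReal (P.density k ω z) * f (trajectory (ω, z)) ∂P.refMeasure π
        ∂P.primitiveLaw := by
  rw [lintegral_lawUpTo _ _ _ _ hf]
  refine lintegral_congr fun ω => ?_
  refine lmarginal_eq_lintegral_of_dependsOn _
    (P.measurable_density_mul k ω hf) (fun z z' hz => ?_) 0
  simp only [mem_timesBefore] at hz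
  simp only [P.density_congr ω hz, h ω z z' hz]

/-- Expectations of functions of the first `k` stages do not change at later stages. -/
lemma lintegral_lawUpTo_mono {k l : ℕ} (hkl : k ≤ l) (hl : l ≤ T)
    {f : D.Primitive × D.Observations × D.Actions → ℝ≥0∞} (hf : Measurable f)
    (h : ∀ (t : Fin T) x q, k ≤ t.1 → f (record t (x, q)) = f x) :
    ∫⁻ x, f x ∂P.lawUpTo π l hl = ∫⁻ x, f x ∂P.lawUpTo π k (hkl.trans hl) := by
  induction l, hkl using Nat.le_induction with
  | base => rfl
  | succ l hkl ih =>
    rw [lawUpTo, Measure.lintegral_bind (P.stepKernel π ⟨l, hl⟩).measurable.aemeasurable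
      hf.aemeasurable, ← ih (Nat.le_of_succ_le hl)]
    refine lintegral_congr fun x => ?_
    rw [lintegral_stepKernel _ _ _ hf]
    simp [h ⟨l, hl⟩ x _ hkl]

/-- The value of `p^i_t` along a trajectory. -/
def target (t : Fin T) (i : Fin N) (x : D.Primitive × D.Observations × D.Actions) : D.Act t i :=
  P.p t i (x.1, D.pastActions t x.2.2, D.pastObservations t x.2.1, x.2.1 t i)

lemma continuous_target (t : Fin T) (i : Fin N) : Continuous (P.target t i) := by
  refine (P.p_continuous t i).comp ?_
  exact continuous_fst.prodMk (((continuous_pastActions t).comp (by fun_prop)).prodMk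
    (((continuous_pastObservations t).comp (by fun_prop)).prodMk (by fun_prop)))

lemma target_congr {t : Fin T} {i : Fin N} {x x' : D.Primitive × D.Observations × D.Actions}
    (h₁ : x.1 = x'.1) (h₂ : ∀ s < t, x.2.1 s = x'.2.1 s) (h₃ : ∀ s < t, x.2.2 s = x'.2.2 s)
    (h₄ : x.2.1 t i = x'.2.1 t i) : P.target t i x = P.target t i x' := by
  unfold target
  rw [h₁, pastActions_congr h₃, pastObservations_congr h₂, h₄]

/-- The summand `‖u^i_t - p^i_t‖²_R` of the cost, with `R = R^i_t`. -/
def stageCost (t : Fin T) (i : Fin N) (x : D.Primitive × D.Observations × D.Actions) : ℝ :=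
  quadForm (P.R t i) (x.2.2 t i - P.target t i x)

lemma stageCost_nonneg (t : Fin T) (i : Fin N) (x : D.Primitive × D.Observations × D.Actions) :
    0 ≤ P.stageCost t i x :=
  quadForm_nonneg (P.R_posDef t i) _

lemma continuous_stageCost (t : Fin T) (i : Fin N) : Continuous (P.stageCost t i) :=
  (continuous_quadForm _).comp (Continuous.sub (by fun_prop) (P.continuous_target t i))

lemma cost_eq_sum_stageCost (x : D.Primitive × D.Observations × D.Actions) :
    P.cost x.1 x.2.1 x.2.2 = (∑ t, ∑ i, P.stageCost t i x) + P.κ x :=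
  P.cost_eq _ _ _

lemma continuous_cost :
    Continuous fun x : D.Primitive × D.Observations × D.Actions => P.cost x.1 x.2.1 x.2.2 := by
  simp_rw [cost_eq_sum_stageCost]
  exact (continuous_finsetSum _ fun t _ => continuous_finsetSum _ fun i _ =>
    P.continuous_stageCost t i).add P.κ_continuous

lemma stageCost_le_cost (t : Fin T) (i : Fin N) (x : D.Primitive × D.Observations × D.Actions) :
    P.stageCost t i x ≤ P.cost x.1 x.2.1 x.2.2 := by
  rw [cost_eq_sum_stageCost]
  have h1 : P.stageCost t i x ≤ ∑ j, P.stageCost t j x :=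
    Finset.single_le_sum (f := fun j => P.stageCost t j x)
      (fun j _ => P.stageCost_nonneg t j x) (Finset.mem_univ i)
  have h2 : ∑ j, P.stageCost t j x ≤ ∑ s, ∑ j, P.stageCost s j x :=
    Finset.single_le_sum (f := fun s => ∑ j, P.stageCost s j x)
      (fun s _ => Finset.sum_nonneg fun j _ => P.stageCost_nonneg s j x) (Finset.mem_univ t)
  linarith [P.κ_nonneg x]

/-- The cost of the statically reduced team: the original cost times the density of the law of
the team with respect to the reference measure. -/
def reducedCost (q : D.Primitive × D.Records) : ℝ :=
  P.density T q.1 q.2 *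
    P.cost (trajectory q).1 (trajectory q).2.1 (trajectory q).2.2

lemma continuous_reducedCost : Continuous P.reducedCost :=
  (P.continuous_density T).mul (P.continuous_cost.comp continuous_trajectory)

/-- The static reduction of the team: the expected cost is the expectation of `reducedCost` under
a measure for which the observations are independent of each other and of `ω₀`. -/
lemma expectedCost_eq :
    P.expectedCost π = ∫⁻ q, ENNReal.ofReal (P.reducedCost q)
      ∂P.primitiveLaw.prod (P.refMeasure π) := by
  have hm : Measurable fun x : D.Primitive × D.Observations × D.Actions =>
    ENNReal.ofReal (P.cost x.1 x.2.1 x.2.2) := P.continuous_cost.measurable.ennreal_ofReal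
  rw [expectedCost, law, lintegral_lawUpTo_eq_lintegral_refMeasure _ _ _ _ hm
    fun ω z z' h => by rw [show z = z' from funext fun t => h t t.2],
    lintegral_prod _ P.continuous_reducedCost.measurable.ennreal_ofReal.aemeasurable]
  refine lintegral_congr fun ω => lintegral_congr fun z => ?_
  rw [reducedCost, ENNReal.ofReal_mul (P.density_pos _ _ _).le]

end LQGTeam

/-! ### Tightness of strategies of bounded cost -/

lemma exists_isCompact_measure_compl_le {E : Type*} [TopologicalSpace E] [PolishSpace E]
    [MeasurableSpace E] [BorelSpace E] (μ : Measure E) [IsFiniteMeasure μ] {ε : ℝ≥0∞}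
    (hε : 0 < ε) : ∃ K, IsCompact K ∧ μ Kᶜ ≤ ε := by
  let _ := TopologicalSpace.upgradeIsCompletelyMetrizable E
  obtain ⟨K, hK, h⟩ := isTightMeasureSet_iff_exists_isCompact_measure_compl_le.1
    (isTightMeasureSet_singleton (μ := μ)) ε hε
  exact ⟨K, hK, h μ rfl⟩

lemma half_le_measure_of_compl_le_half {E : Type*} [MeasurableSpace E] (μ : Measure E)
    [IsProbabilityMeasure μ] {K : Set E} (hK : μ Kᶜ ≤ 1 / 2) : 1 / 2 ≤ μ K := by
  have h : (1 : ℝ≥0∞) ≤ μ K + μ Kᶜ := by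
    rw [← measure_univ (μ := μ), ← Set.union_compl_self K]
    exact measure_union_le _ _
  have h2 : (1 : ℝ≥0∞) / 2 + 1 / 2 ≤ μ K + 1 / 2 := by
    rw [ENNReal.add_halves]; exact h.trans (by gcongr)
  exact (ENNReal.add_le_add_iff_right (by simp)).1 h2

lemma prod_prod_ite_eq {N T : ℕ} (t : Fin T) (i : Fin N) (m : ℝ≥0∞) :
    ∏ s : Fin T, ∏ j : Fin N, (if s = t ∧ j = i then m else 1) = m := by
  rw [Finset.prod_eq_single t (fun s _ hs => by simp [hs]) (by simp)]
  simp

namespace LQGTeam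

variable {N T : ℕ} {D : TeamDims N T} (P : LQGTeam D)
  (π : (t : Fin T) → (i : Fin N) → D.BehavioralStrategy t i)

lemma refLaw_fst (t : Fin T) (i : Fin N) (σ : D.BehavioralStrategy t i) :
    (P.refLaw t i σ).fst = P.noiseLaw t i :=
  haveI := σ.2
  Measure.fst_compProd (P.noiseLaw t i) σ.1

lemma refLaw_preimage_fst (t : Fin T) (i : Fin N) (σ : D.BehavioralStrategy t i)
    {B : Set (D.Obs t i)} (hB : MeasurableSet B) :
    P.refLaw t i σ (Prod.fst ⁻¹' B) = P.noiseLaw t i B := by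
  rw [← P.refLaw_fst t i σ, Measure.fst_apply hB]

/-- Later stages do not matter for the expectation of the stage cost. -/
lemma lintegral_stageCost_le (t : Fin T) (i : Fin N) :
    ∫⁻ ω, ∫⁻ z, ENNReal.ofReal (P.density (t + 1) ω z) *
      ENNReal.ofReal (P.stageCost t i (trajectory (ω, z))) ∂P.refMeasure π ∂P.primitiveLaw ≤
    P.expectedCost π := by
  have hm : Measurable fun x => ENNReal.ofReal (P.stageCost t i x) :=
    (P.continuous_stageCost t i).measurable.ennreal_ofReal
  have h1 := P.lintegral_lawUpTo_eq_lintegral_refMeasure π (t + 1) t.2 hm fun ω z z' h => by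
    have ht : z t = z' t := h t (Nat.lt_succ_self _)
    have hs (s : Fin T) (hs : s < t) : z s = z' s := h s (Nat.lt_succ_of_lt hs)
    have h2 : P.target t i (trajectory (ω, z)) = P.target t i (trajectory (ω, z')) :=
      P.target_congr rfl (fun s h => by simp only [trajectory, hs s h])
        (fun s h => by simp only [trajectory, hs s h]) (by simp only [trajectory, ht])
    unfold stageCost
    rw [h2]
    simp only [trajectory, ht]
  rw [← h1, ← P.lintegral_lawUpTo_mono π t.2 le_rfl hm fun s x q hs => ?_]
  · exact lintegral_mono fun x => ENNReal.ofReal_le_ofReal (P.stageCost_le_cost t i x)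
  · have hts : t ≠ s := fun h => by rw [h] at hs; exact Nat.not_succ_le_self _ hs
    have hs' (r : Fin T) (hr : r < t) : r ≠ s := fun h => by
      have : r.1 < t.1 := hr
      rw [h] at this
      omega
    have h2 : P.target t i (record s (x, q)) = P.target t i x :=
      P.target_congr rfl (fun r hr => Function.update_of_ne (hs' r hr) _ _)
        (fun r hr => Function.update_of_ne (hs' r hr) _ _)
        (by simp only [record, Function.update_of_ne hts])
    unfold stageCost
    rw [h2]
    simp only [record, Function.update_of_ne hts]

/-- On a set of trajectories whose past (before `t`) and present observations lie in compact sets,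
the density is bounded below and the target `p^i_t` is bounded: both are continuous and do not
depend on the remaining coordinates. -/
lemma exists_density_target_bounds (t : Fin T) (i : Fin N) {K₀ : Set D.Primitive}
    (hK₀ : IsCompact K₀) {K : (s : Fin T) → (j : Fin N) → Set (D.Obs s j × D.Act s j)}
    (hK : ∀ s < t, ∀ j, IsCompact (K s j)) {B : (s : Fin T) → (j : Fin N) → Set (D.Obs s j)}
    (hB : ∀ s j, IsCompact (B s j)) :
    ∃ δ > 0, ∃ M : ℝ, ∀ ω ∈ K₀, ∀ z : D.Records, (∀ s < t, ∀ j, z s j ∈ K s j) →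
      (∀ s j, t ≤ s → (z s j).1 ∈ B s j) →
      δ ≤ P.density (t + 1) ω z ∧ ‖P.target t i (trajectory (ω, z))‖ ≤ M := by
  let L : (s : Fin T) → (j : Fin N) → Set (D.Obs s j × D.Act s j) := fun s j =>
    if s < t then K s j else B s j ×ˢ {0}
  have hL : IsCompact (K₀ ×ˢ Set.univ.pi fun s => Set.univ.pi fun j => L s j) := by
    refine hK₀.prod (isCompact_univ_pi fun s => isCompact_univ_pi fun j => ?_)
    by_cases hs : s < t
    · simpa only [L, if_pos hs] using hK s hs j
    · simpa only [L, if_neg hs] using (hB s j).prod isCompact_singleton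
  have hc : Continuous fun q : D.Primitive × D.Records => P.target t i (trajectory q) :=
    (P.continuous_target t i).comp continuous_trajectory
  obtain ⟨δ, hδ, h1⟩ := hL.exists_forall_le'
    (f := fun q : D.Primitive × D.Records => P.density (t + 1) q.1 q.2)
    (P.continuous_density (t + 1)).continuousOn (a := 0) fun q _ => P.density_pos _ _ _
  obtain ⟨M, h2⟩ := hL.exists_bound_of_continuousOn
    (f := fun q : D.Primitive × D.Records => P.target t i (trajectory q)) hc.continuousOn
  refine ⟨δ, hδ, M, fun ω hω z hz hz' => ?_⟩
  -- `z'` has the same past and the same observations as `z`, and its other actions are `0`.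
  let z' : D.Records := fun s j => if s < t then z s j else ((z s j).1, 0)
  have hlt (s : Fin T) (hs : s < t) : z s = z' s := by
    funext j; simp only [z', if_pos hs]
  have hfst (j : Fin N) : (z t j).1 = (z' t j).1 := by
    simp only [z', if_neg (lt_irrefl t)]
  have hmem : (ω, z') ∈ K₀ ×ˢ Set.univ.pi fun s => Set.univ.pi fun j => L s j := by
    refine ⟨hω, fun s _ j _ => ?_⟩
    by_cases hs : s < t
    · simpa only [L, z', if_pos hs] using hz s hs j
    · simpa only [L, z', if_neg hs] using ⟨hz' s j (not_lt.1 hs), rfl⟩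
  have hd : P.density (t + 1) ω z = P.density (t + 1) ω z' := by
    rw [P.density_succ t.2, P.density_succ t.2, P.density_congr ω fun s hs => hlt s hs,
      P.stageDensity_congr ω (fun s hs => hlt s hs) hfst]
  have ht : P.target t i (trajectory (ω, z)) = P.target t i (trajectory (ω, z')) :=
    P.target_congr rfl (fun s hs => by simp only [trajectory, hlt s hs])
      (fun s hs => by simp only [trajectory, hlt s hs]) (hfst i)
  rw [hd, ht]
  exact ⟨h1 (ω, z') hmem, h2 (ω, z') hmem⟩

lemma refMeasure_pi (E : (s : Fin T) → (j : Fin N) → Set (D.Obs s j × D.Act s j)) :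
    P.refMeasure π (Set.univ.pi fun s => Set.univ.pi fun j => E s j) =
      ∏ s, ∏ j, P.refLaw s j (π s j) (E s j) := by
  simp only [refMeasure, Measure.pi_pi]

/-- Markov's inequality under the reference measure: if the stage cost, weighted by the density, is
at least `Λ` on a product set of which all factors but the one of `(y^i_t, u^i_t)` have probability
at least `1/2`, then a bound on the expected cost bounds the probability of that factor. -/
lemma measure_le_of_density_mul_stageCost_le (t : Fin T) (i : Fin N) {K₀ : Set D.Primitive}
    (hK₀ : MeasurableSet K₀) (hK₀' : 1 / 2 ≤ P.primitiveLaw K₀)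
    {E : (s : Fin T) → (j : Fin N) → Set (D.Obs s j × D.Act s j)}
    (hE : ∀ s j, MeasurableSet (E s j))
    (hE' : ∀ s j, ¬ (s = t ∧ j = i) → 1 / 2 ≤ P.refLaw s j (π s j) (E s j)) {Λ : ℝ}
    (h : ∀ ω ∈ K₀, ∀ z : D.Records, (∀ s j, z s j ∈ E s j) →
      Λ ≤ P.density (t + 1) ω z * P.stageCost t i (trajectory (ω, z))) :
    ENNReal.ofReal Λ * ((1 / 2) * (∏ _s : Fin T, ∏ _j : Fin N, (1 / 2)) *
      P.refLaw t i (π t i) (E t i)) ≤ P.expectedCost π := by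
  set m := P.refLaw t i (π t i) (E t i)
  let Q : Set D.Records := Set.univ.pi fun s => Set.univ.pi fun j => E s j
  have hQ : MeasurableSet Q :=
    MeasurableSet.univ_pi fun s => MeasurableSet.univ_pi fun j => hE s j
  have hQ' : (∏ _s : Fin T, ∏ _j : Fin N, (1 / 2 : ℝ≥0∞)) * m ≤ P.refMeasure π Q := by
    rw [refMeasure_pi]
    conv_lhs => rw [← prod_prod_ite_eq t i m, ← Finset.prod_mul_distrib]
    refine Finset.prod_le_prod' fun s _ => ?_
    rw [← Finset.prod_mul_distrib]
    refine Finset.prod_le_prod' fun j _ => ?_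
    by_cases hsj : s = t ∧ j = i
    · rw [if_pos hsj]
      obtain ⟨rfl, rfl⟩ := hsj
      exact mul_le_of_le_one_left' (by simp)
    · rw [if_neg hsj, mul_one]
      exact hE' s j hsj
  refine le_trans ?_ (P.lintegral_stageCost_le π t i)
  calc ENNReal.ofReal Λ * ((1 / 2) * (∏ _s : Fin T, ∏ _j : Fin N, (1 / 2)) * m)
      ≤ ENNReal.ofReal Λ * P.refMeasure π Q * P.primitiveLaw K₀ := by
        rw [mul_assoc, mul_assoc (ENNReal.ofReal Λ), mul_comm (P.refMeasure π Q)]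
        gcongr
    _ = ∫⁻ _ω in K₀, ∫⁻ _z in Q, ENNReal.ofReal Λ ∂P.refMeasure π ∂P.primitiveLaw := by
        simp only [lintegral_const, Measure.restrict_apply MeasurableSet.univ, Set.univ_inter]
    _ ≤ ∫⁻ ω in K₀, ∫⁻ z in Q, ENNReal.ofReal (P.density (t + 1) ω z) *
          ENNReal.ofReal (P.stageCost t i (trajectory (ω, z))) ∂P.refMeasure π
            ∂P.primitiveLaw := by
        refine setLIntegral_mono' hK₀ fun ω hω => setLIntegral_mono' hQ fun z hz => ?_
        rw [← ENNReal.ofReal_mul (P.density_pos _ _ _).le]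
        exact ENNReal.ofReal_le_ofReal (h ω hω z fun s j => hz s trivial j trivial)
    _ ≤ _ := (setLIntegral_le_lintegral _ _).trans
        (lintegral_mono fun ω => setLIntegral_le_lintegral _ _)

/-- Tightness, stage by stage. If the reference laws before time `t` are tight, then on a set of
trajectories of probability bounded below the density is bounded below and the target `p^i_t` is
bounded; a bound on the cost then bounds the probability that `u^i_t` is large. -/
lemma exists_isCompact_refLaw_compl_le {C : ℝ≥0∞} (hC : C ≠ ∞) (t : Fin T) (i : Fin N) :
    ∀ ε > 0, ∃ K, IsCompact K ∧ ∀ π : (t : Fin T) → (i : Fin N) → D.BehavioralStrategy t i,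
      P.expectedCost π ≤ C → P.refLaw t i (π t i) Kᶜ ≤ ε := by
  induction t using WellFoundedLT.induction generalizing i with
  | ind t ih =>
  intro ε hε
  have hK (s : Fin T) (j : Fin N) : ∃ K : Set (D.Obs s j × D.Act s j), s < t → IsCompact K ∧
      ∀ π : (t : Fin T) → (i : Fin N) → D.BehavioralStrategy t i,
        P.expectedCost π ≤ C → P.refLaw s j (π s j) Kᶜ ≤ 1 / 2 := by
    by_cases hs : s < t
    · obtain ⟨K, h⟩ := ih s hs j (1 / 2) (by simp)
      exact ⟨K, fun _ => h⟩
    · exact ⟨∅, fun h => absurd h hs⟩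
  choose K hK using hK
  obtain ⟨K₀, hK₀, hK₀'⟩ := exists_isCompact_measure_compl_le P.primitiveLaw
    (ε := 1 / 2) (by simp)
  have hB (s : Fin T) (j : Fin N) : ∃ B, IsCompact B ∧
      P.noiseLaw s j Bᶜ ≤ min (ε / 2) (1 / 2) :=
    exists_isCompact_measure_compl_le _ (lt_min (ENNReal.half_pos hε.ne') (by simp))
  choose B hB hB' using hB
  obtain ⟨δ, hδ, M, hM⟩ := P.exists_density_target_bounds t i hK₀ (fun s hs j => (hK s j hs).1) hB
  obtain ⟨c, hc, hR⟩ := exists_pos_mul_sq_norm_le_quadForm (P.R_posDef t i)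
  set b : ℝ≥0∞ := (1 / 2) * ∏ _s : Fin T, ∏ _j : Fin N, (1 / 2)
  have hb : b ≠ 0 := by
    simp [b]
  -- The radius is such that a deviation of size `r` from the target costs more than `C` if it has
  -- probability more than `ε / 2`.
  have hbε : b * (ε / 2) ≠ 0 := mul_ne_zero hb (ENNReal.half_pos hε.ne').ne'
  set Λ : ℝ := (C / (b * (ε / 2))).toReal + 1
  have hΛ : 0 < Λ := by positivity
  have hCΛ : C < ENNReal.ofReal Λ * (b * (ε / 2)) := by
    rw [← ENNReal.div_lt_iff (.inl hbε) (.inr hC)]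
    exact (ENNReal.lt_ofReal_iff_toReal_lt (ENNReal.div_ne_top hC hbε)).2 (lt_add_one _)
  set r : ℝ := Real.sqrt (Λ / (δ * c))
  have hr : δ * (c * r ^ 2) = Λ := by
    rw [Real.sq_sqrt (by positivity)]
    field_simp
  let F : Set (D.Obs t i × D.Act t i) := B t i ×ˢ {u | M + r < ‖u‖}
  refine ⟨B t i ×ˢ Metric.closedBall 0 (M + r), (hB t i).prod (isCompact_closedBall _ _),
    fun π hπ => ?_⟩
  have hBt : P.refLaw t i (π t i) (Prod.fst ⁻¹' (B t i)ᶜ) ≤ ε / 2 := by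
    rw [P.refLaw_preimage_fst t i _ (hB t i).measurableSet.compl]
    exact (hB' t i).trans (min_le_left _ _)
  have hFt : P.refLaw t i (π t i) F ≤ ε / 2 := by
    -- The past and the observations stay in compact sets, while `u^i_t` is far away.
    let E : (s : Fin T) → (j : Fin N) → Set (D.Obs s j × D.Act s j) := fun s j =>
      if s < t then K s j else
        Prod.fst ⁻¹' B s j ∩ {q | s = t ∧ j = i → M + r < ‖q.2‖}
    have hE (s : Fin T) (j : Fin N) : MeasurableSet (E s j) := by
      by_cases hs : s < t
      · simpa only [E, if_pos hs] using (hK s j hs).1.measurableSet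
      · simp only [E, if_neg hs]
        refine (measurable_fst (hB s j).measurableSet).inter ?_
        by_cases hsj : s = t ∧ j = i
        · simpa only [hsj, true_imp_iff, and_self] using
            measurableSet_lt measurable_const
              (measurable_snd.norm : Measurable fun q : D.Obs s j × D.Act s j => ‖q.2‖)
        · simp only [hsj, false_imp_iff, Set.ofPred_true, MeasurableSet.univ]
    have hE' (s : Fin T) (j : Fin N) (hsj : ¬ (s = t ∧ j = i)) :
        1 / 2 ≤ P.refLaw s j (π s j) (E s j) := by
      by_cases hs : s < t
      · simpa only [E, if_pos hs] using half_le_measure_of_compl_le_half _ ((hK s j hs).2 π hπ)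
      · simp only [E, if_neg hs, hsj, false_imp_iff, Set.ofPred_true, Set.inter_univ]
        rw [P.refLaw_preimage_fst s j _ (hB s j).measurableSet]
        exact half_le_measure_of_compl_le_half _ ((hB' s j).trans (min_le_right _ _))
    have hEt : E t i = F := by
      ext q
      simp [E, F]
    have key := P.measure_le_of_density_mul_stageCost_le π t i hK₀.measurableSet
      (half_le_measure_of_compl_le_half _ hK₀') hE hE' (Λ := Λ) fun ω hω z hz => by
        obtain ⟨h1, h2⟩ := hM ω hω z
          (fun s hs j => by simpa only [E, if_pos hs] using hz s j)
          (fun s j hs => by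
            have := hz s j
            simp only [E, if_neg hs.not_gt] at this
            exact this.1)
        have hz' : z t i ∈ F := hEt ▸ hz t i
        have h3 : r ≤ ‖(z t i).2 - P.target t i (trajectory (ω, z))‖ := by
          have h4 : M + r < ‖(z t i).2‖ := hz'.2
          have h5 := norm_sub_norm_le (z t i).2 (P.target t i (trajectory (ω, z)))
          linarith
        have h0 := (P.density_pos (t + 1) ω z).le
        calc Λ = δ * (c * r ^ 2) := hr.symm
          _ ≤ P.density (t + 1) ω z *
              (c * ‖(z t i).2 - P.target t i (trajectory (ω, z))‖ ^ 2) := by gcongr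
          _ ≤ _ := mul_le_mul_of_nonneg_left (hR _) h0
    rw [hEt] at key
    by_contra! hlt
    refine absurd (key.trans hπ) (not_le.2 (hCΛ.trans_le ?_))
    gcongr
  have hsub : (B t i ×ˢ Metric.closedBall 0 (M + r))ᶜ ⊆ Prod.fst ⁻¹' (B t i)ᶜ ∪ F := by
    rintro ⟨y, u⟩ hq
    by_cases hy : y ∈ B t i
    · refine .inr ⟨hy, ?_⟩
      by_contra hu
      exact hq ⟨hy, mem_closedBall_zero_iff.2 (not_lt.1 hu)⟩
    · exact .inl hy
  calc P.refLaw t i (π t i) (B t i ×ˢ Metric.closedBall 0 (M + r))ᶜ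
      ≤ P.refLaw t i (π t i) (Prod.fst ⁻¹' (B t i)ᶜ) + P.refLaw t i (π t i) F :=
        (measure_mono hsub).trans (measure_union_le _ _)
    _ ≤ ε / 2 + ε / 2 := add_le_add hBt hFt
    _ = ε := ENNReal.add_halves ε

end LQGTeam

/-! ### Existence of an optimal behavioral strategy -/

/-- The integral of a nonnegative continuous function is a supremum of integrals of bounded
continuous functions, hence lower semicontinuous for the weak topology. -/
lemma lowerSemicontinuous_lintegral_ofReal {E : Type*} [TopologicalSpace E] [MeasurableSpace E]
    [OpensMeasurableSpace E] {f : E → ℝ} (hf : Continuous f) :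
    LowerSemicontinuous fun μ : ProbabilityMeasure E =>
      ∫⁻ x, ENNReal.ofReal (f x) ∂(μ : Measure E) := by
  have hb (n : ℕ) : ∃ g : BoundedContinuousFunction E NNReal,
      ∀ x, (g x : ℝ≥0∞) = min (ENNReal.ofReal (f x)) n := by
    refine ⟨BoundedContinuousFunction.mkOfBound ⟨fun x => min (Real.toNNReal (f x)) n,
      by fun_prop⟩ n fun x y => ?_, fun x => ?_⟩
    · rw [NNReal.dist_eq, abs_le]
      have h1 : ((min (Real.toNNReal (f x)) n : NNReal) : ℝ) ≤ n := by
        exact_mod_cast min_le_right _ _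
      have h2 : ((min (Real.toNNReal (f y)) n : NNReal) : ℝ) ≤ n := by
        exact_mod_cast min_le_right _ _
      have h3 := (min (Real.toNNReal (f x)) (n : NNReal)).2
      have h4 := (min (Real.toNNReal (f y)) (n : NNReal)).2
      constructor <;> simp only [ContinuousMap.coe_mk] <;> linarith [NNReal.coe_nonneg]
    · simp [ENNReal.ofReal]
  choose g hg using hb
  have h (μ : ProbabilityMeasure E) : ∫⁻ x, ENNReal.ofReal (f x) ∂(μ : Measure E) =
      ⨆ n, ∫⁻ x, g n x ∂(μ : Measure E) := by
    rw [← lintegral_iSup (fun n => (g n).continuous.measurable.coe_nnreal_ennreal)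
      (fun m n hmn x => by simp only [hg]; gcongr)]
    refine lintegral_congr fun x => ?_
    simp only [hg]
    refine le_antisymm ?_ (iSup_le fun n => min_le_left _ _)
    obtain ⟨n, hn⟩ := exists_nat_ge (f x)
    refine le_iSup_of_le n (le_min le_rfl ?_)
    rw [← ENNReal.ofReal_natCast]
    exact ENNReal.ofReal_le_ofReal hn
  simp_rw [h]
  refine lowerSemicontinuous_iSup fun n => Continuous.lowerSemicontinuous ?_
  rw [continuous_iff_continuousAt]
  intro μ
  exact ProbabilityMeasure.tendsto_iff_forall_lintegral_tendsto.1 Filter.tendsto_id (g n)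

namespace LQGTeam

variable {N T : ℕ} {D : TeamDims N T} (P : LQGTeam D)

/-- The tuple of reference laws of the observation–action pairs of all agents at all times. -/
def refLaws (π : (t : Fin T) → (i : Fin N) → D.BehavioralStrategy t i) :
    (t : Fin T) → (i : Fin N) → ProbabilityMeasure (D.Obs t i × D.Act t i) :=
  fun t i => ⟨P.refLaw t i (π t i), inferInstance⟩

/-- The expectation of the reduced cost when the observation–action pairs are independent with
prescribed laws. -/
def reducedExpectedCost
    (ν : (t : Fin T) → (i : Fin N) → ProbabilityMeasure (D.Obs t i × D.Act t i)) : ℝ≥0∞ :=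
  ∫⁻ q, ENNReal.ofReal (P.reducedCost q)
    ∂(ProbabilityMeasure.prod ⟨P.primitiveLaw, inferInstance⟩
      (ProbabilityMeasure.pi fun t => ProbabilityMeasure.pi fun i => ν t i) :
        ProbabilityMeasure (D.Primitive × D.Records))

lemma reducedExpectedCost_refLaws
    (π : (t : Fin T) → (i : Fin N) → D.BehavioralStrategy t i) :
    P.reducedExpectedCost (P.refLaws π) = P.expectedCost π :=
  (P.expectedCost_eq π).symm

lemma lowerSemicontinuous_reducedExpectedCost : LowerSemicontinuous P.reducedExpectedCost := by
  refine (lowerSemicontinuous_lintegral_ofReal P.continuous_reducedCost).comp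
    (ProbabilityMeasure.continuous_prod.comp
      (Continuous.prodMk continuous_const (ProbabilityMeasure.continuous_pi.comp ?_)))
  exact _root_.continuous_pi fun t => ProbabilityMeasure.continuous_pi.comp (continuous_apply t)

/-- A tuple of laws whose observation marginals are the noise laws comes from behavioral
strategies, by disintegration. -/
lemma exists_refLaws_eq {ν : (t : Fin T) → (i : Fin N) → ProbabilityMeasure (D.Obs t i × D.Act t i)}
    (h : ∀ t i, (ν t i : Measure (D.Obs t i × D.Act t i)).fst = P.noiseLaw t i) :
    ∃ π, P.refLaws π = ν := by
  refine ⟨fun t i => ⟨(ν t i : Measure (D.Obs t i × D.Act t i)).condKernel, inferInstance⟩, ?_⟩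
  funext t i
  refine Subtype.ext ?_
  change P.noiseLaw t i ⊗ₘ _ = _
  rw [← h t i]
  exact Measure.disintegrate _ _

lemma isClosed_setOf_fst_eq (t : Fin T) (i : Fin N) :
    IsClosed {ν : ProbabilityMeasure (D.Obs t i × D.Act t i) |
      (ν : Measure (D.Obs t i × D.Act t i)).fst = P.noiseLaw t i} := by
  let ν₀ : ProbabilityMeasure (D.Obs t i) := ⟨P.noiseLaw t i, inferInstance⟩
  have h := (isClosed_singleton (x := ν₀)).preimage
      (ProbabilityMeasure.continuous_map (continuous_fst : Continuous
        (Prod.fst : D.Obs t i × D.Act t i → D.Obs t i)))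
  convert h using 1
  ext ν
  exact (Subtype.ext_iff (a1 := ν.map _) (a2 := ν₀)).symm

/-- By Prokhorov's theorem, the reference laws of the strategies of cost at most `C` lie in a
compact set of tuples of laws with the right observation marginals. -/
lemma exists_isCompact_refLaws {C : ℝ≥0∞} (hC : C ≠ ∞) :
    ∃ S : Set ((t : Fin T) → (i : Fin N) → ProbabilityMeasure (D.Obs t i × D.Act t i)),
      IsCompact S ∧ (∀ π, P.expectedCost π ≤ C → P.refLaws π ∈ S) ∧
        ∀ ν ∈ S, ∃ π, P.refLaws π = ν := by
  let A : (t : Fin T) → (i : Fin N) → Set (ProbabilityMeasure (D.Obs t i × D.Act t i)) :=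
    fun t i => {ν | ∃ π, P.expectedCost π ≤ C ∧ P.refLaws π t i = ν}
  have hA (t : Fin T) (i : Fin N) : IsCompact (closure (A t i)) := by
    refine isCompact_closure_of_isTightMeasureSet ?_
    rw [isTightMeasureSet_iff_exists_isCompact_measure_compl_le]
    intro ε hε
    obtain ⟨K, hK, h⟩ := P.exists_isCompact_refLaw_compl_le hC t i ε hε
    refine ⟨K, hK, ?_⟩
    rintro _ ⟨_, ⟨π, hπ, rfl⟩, rfl⟩
    exact h π hπ
  refine ⟨Set.univ.pi fun t => Set.univ.pi fun i => closure (A t i),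
    isCompact_univ_pi fun t => isCompact_univ_pi fun i => hA t i,
    fun π hπ t _ i _ => subset_closure ⟨π, hπ, rfl⟩, fun ν hν => P.exists_refLaws_eq fun t i => ?_⟩
  refine closure_minimal ?_ (P.isClosed_setOf_fst_eq t i) (hν t trivial i trivial)
  rintro _ ⟨π, -, rfl⟩
  exact P.refLaw_fst t i (π t i)

lemma exists_forall_expectedCost_le (π₀ : (t : Fin T) → (i : Fin N) → D.BehavioralStrategy t i) :
    ∃ π, ∀ π', P.expectedCost π ≤ P.expectedCost π' := by
  -- If every strategy has infinite cost, all of them are optimal.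
  by_cases htop : ∀ π, P.expectedCost π = ∞
  · exact ⟨π₀, fun π' => by rw [htop π']; exact le_top⟩
  push Not at htop
  obtain ⟨π₁, hπ₁⟩ := htop
  obtain ⟨S, hS, hmem, hsurj⟩ := P.exists_isCompact_refLaws hπ₁
  obtain ⟨ν, hν, hmin⟩ := (P.lowerSemicontinuous_reducedExpectedCost.lowerSemicontinuousOn S
    ).exists_isMinOn ⟨_, hmem π₁ le_rfl⟩ hS
  obtain ⟨π, rfl⟩ := hsurj ν hν
  have h (π' : (t : Fin T) → (i : Fin N) → D.BehavioralStrategy t i)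
      (h' : P.expectedCost π' ≤ P.expectedCost π₁) : P.expectedCost π ≤ P.expectedCost π' := by
    simpa only [reducedExpectedCost_refLaws] using isMinOn_iff.1 hmin _ (hmem π' h')
  refine ⟨π, fun π' => ?_⟩
  rcases le_total (P.expectedCost π') (P.expectedCost π₁) with h' | h'
  · exact h π' h'
  · exact (h π₁ le_rfl).trans h'

end LQGTeam

/-! ### Purification -/

/-- A product of mixtures is a mixture of products. -/
lemma pi_bind {N : ℕ} {X Y : Fin N → Type*} [∀ i, MeasurableSpace (X i)]
    [∀ i, MeasurableSpace (Y i)] (ρ : (i : Fin N) → Measure (X i))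
    [∀ i, IsProbabilityMeasure (ρ i)] (κ : (i : Fin N) → Kernel (X i) (Y i))
    [∀ i, IsMarkovKernel (κ i)] :
    Measure.pi (fun i => (ρ i).bind (κ i)) = (Measure.pi ρ).bind (piKernel fun i =>
      (κ i).comap (fun x : (i : Fin N) → X i => x i) (measurable_pi_apply i)) := by
  refine Measure.pi_eq fun s hs => ?_
  rw [Measure.bind_apply (MeasurableSet.univ_pi hs) (Kernel.aemeasurable _)]
  have h (x : (i : Fin N) → X i) :
      piKernel (fun i => (κ i).comap (fun x : (i : Fin N) → X i => x i) (measurable_pi_apply i)) x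
        (Set.univ.pi s) = ∏ i, κ i (x i) (s i) :=
    Measure.pi_pi _ _
  simp_rw [h]
  rw [lintegral_prod_eval_pi ρ fun i => Kernel.measurable_coe (κ i) (hs i)]
  exact Finset.prod_congr rfl fun i _ => by
    rw [Measure.bind_apply (hs i) (Kernel.aemeasurable _)]

namespace LQGTeam

variable {N T : ℕ} {D : TeamDims N T} (P : LQGTeam D)

lemma refLaw_toBehavioral_apply (t : Fin T) (i : Fin N) (γ : D.DeterministicStrategy t i) :
    P.refLaw t i γ.toBehavioral = (P.noiseLaw t i).map fun y => (y, γ.1 y) :=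
  Measure.compProd_deterministic γ.2

/-- A randomized action is a function of the observation and of an independent uniform seed, so
the reference law of a behavioral strategy is a mixture of those of deterministic strategies. -/
lemma exists_refLaw_eq_bind (t : Fin T) (i : Fin N) (σ : D.BehavioralStrategy t i) :
    ∃ (γ : unitInterval → D.DeterministicStrategy t i)
      (κ : Kernel unitInterval (D.Obs t i × D.Act t i)),
      IsMarkovKernel κ ∧ (∀ x, κ x = P.refLaw t i (γ x).toBehavioral) ∧
        P.refLaw t i σ = (volume : Measure unitInterval).bind κ := by
  have := σ.2
  obtain ⟨g, hgm, hg⟩ := Kernel.exists_measurable_map_eq_unitInterval σ.1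
  let γ (x : unitInterval) : D.DeterministicStrategy t i :=
    ⟨fun y => g y x, hgm.comp measurable_prodMk_right⟩
  have hm : Measurable fun r : D.Obs t i × unitInterval => (r.1, g r.1 r.2) :=
    measurable_fst.prodMk hgm
  let κ : Kernel unitInterval (D.Obs t i × D.Act t i) :=
    ((Kernel.const unitInterval (P.noiseLaw t i)) ×ₖ Kernel.id).map fun r => (r.1, g r.1 r.2)
  have hκ : IsMarkovKernel κ := Kernel.IsMarkovKernel.map _ hm
  have hκγ (x : unitInterval) : κ x = P.refLaw t i (γ x).toBehavioral := by
    rw [refLaw_toBehavioral_apply, Kernel.map_apply _ hm, Kernel.prod_apply, Kernel.const_apply,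
      Kernel.id_apply, Measure.prod_dirac, Measure.map_map hm measurable_prodMk_right]
    rfl
  refine ⟨γ, κ, hκ, hκγ, ?_⟩
  ext s hs
  have hs' : MeasurableSet ((fun r : D.Obs t i × unitInterval => (r.1, g r.1 r.2)) ⁻¹' s) := hm hs
  have h1 (x : unitInterval) : κ x s =
      P.noiseLaw t i ((fun y => (y, x)) ⁻¹'
        ((fun r : D.Obs t i × unitInterval => (r.1, g r.1 r.2)) ⁻¹' s)) := by
    rw [Kernel.map_apply _ hm, Measure.map_apply hm hs, Kernel.prod_apply, Kernel.const_apply,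
      Kernel.id_apply, Measure.prod_dirac, Measure.map_apply measurable_prodMk_right hs']
  rw [Measure.bind_apply hs κ.aemeasurable, refLaw, Measure.compProd_apply hs]
  simp_rw [h1]
  rw [← Measure.prod_apply_symm hs', Measure.prod_apply hs']
  refine lintegral_congr fun y => ?_
  have hgy : Measurable (g y) := hgm.comp measurable_prodMk_left
  rw [← hg y, Measure.map_apply hgy (measurable_prodMk_left hs)]
  rfl

/-- The reference measure of a strategy profile is a mixture of those of deterministic profiles,
and the expected cost is affine in the reference measure; hence some deterministic profile does
at least as well. -/
lemma exists_deterministic_expectedCost_le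
    (π : (t : Fin T) → (i : Fin N) → D.BehavioralStrategy t i) :
    ∃ γ : (t : Fin T) → (i : Fin N) → D.DeterministicStrategy t i,
      P.expectedCost (fun t i => (γ t i).toBehavioral) ≤ P.expectedCost π := by
  choose γ κ hκ hκγ hπ using fun t i => P.exists_refLaw_eq_bind t i (π t i)
  let η := piKernel fun t => (piKernel fun i => (κ t i).comap (fun x : Fin N → unitInterval => x i)
    (measurable_pi_apply i)).comap (fun x : Fin T → Fin N → unitInterval => x t)
    (measurable_pi_apply t)
  have hQ : P.refMeasure π =
      (Measure.pi fun _ : Fin T => Measure.pi fun _ : Fin N => volume).bind η := by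
    rw [← pi_bind]
    simp_rw [← pi_bind, ← hπ]
    rfl
  have hη (x : Fin T → Fin N → unitInterval) :
      η x = P.refMeasure fun t i => (γ t i (x t i)).toBehavioral := by
    simp only [refMeasure, ← hκγ]
    rfl
  have hF : Measurable fun q => ENNReal.ofReal (P.reducedCost q) :=
    P.continuous_reducedCost.measurable.ennreal_ofReal
  have hG : Measurable fun z => ∫⁻ ω, ENNReal.ofReal (P.reducedCost (ω, z)) ∂P.primitiveLaw :=
    hF.lintegral_prod_left'
  have hJ (σ : (t : Fin T) → (i : Fin N) → D.BehavioralStrategy t i) : P.expectedCost σ =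
      ∫⁻ z, ∫⁻ ω, ENNReal.ofReal (P.reducedCost (ω, z)) ∂P.primitiveLaw ∂P.refMeasure σ := by
    rw [expectedCost_eq, lintegral_prod_symm _ hF.aemeasurable]
  have hmix : P.expectedCost π = ∫⁻ x, P.expectedCost (fun t i => (γ t i (x t i)).toBehavioral)
      ∂Measure.pi fun _ : Fin T => Measure.pi fun _ : Fin N => volume := by
    simp_rw [hJ, ← hη]
    rw [hQ, Measure.lintegral_bind η.aemeasurable hG.aemeasurable]
  have hm : Measurable fun x : Fin T → Fin N → unitInterval =>
      P.expectedCost fun t i => (γ t i (x t i)).toBehavioral := by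
    simp_rw [hJ, ← hη]
    exact hG.lintegral_kernel
  obtain ⟨x, hx⟩ := exists_le_lintegral (μ := Measure.pi fun _ : Fin T => Measure.pi
    fun _ : Fin N => (volume : Measure unitInterval)) hm.aemeasurable
  exact ⟨fun t i => γ t i (x t i), hx.trans_eq hmix.symm⟩

theorem admitsDeterministicTeamOptimum : P.AdmitsDeterministicTeamOptimum := by
  obtain ⟨π, hπ⟩ := P.exists_forall_expectedCost_le
    fun t i => DeterministicStrategy.toBehavioral ⟨fun _ => 0, measurable_const⟩
  obtain ⟨γ, hγ⟩ := P.exists_deterministic_expectedCost_le π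
  exact ⟨γ, le_antisymm (le_iInf fun π' => hγ.trans (hπ π')) (iInf_le _ _)⟩

end LQGTeam

end

end LQG

theorem mainTheorem2 :
    (∀ (N T : ℕ) (D : LQG.TeamDims N T) (P : LQG.LQGTeam D), P.AdmitsDeterministicTeamOptimum) ∧
    (∀ (n : ℕ) (SX SW : Matrix (Fin n) (Fin n) ℝ) (hX : SX.PosDef) (hW : SW.PosDef)
      (lam : ℝ) (hlam : 0 < lam),
      (LQG.vectorWitsenhausen n SX SW hX hW lam hlam).AdmitsDeterministicTeamOptimum) ∧
    (∀ (n m l : ℕ) (SX : Matrix (Fin n) (Fin n) ℝ) (SW : Matrix (Fin m) (Fin m) ℝ)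
      (hX : SX.PosDef) (hW : SW.PosDef) (H : Matrix (Fin l) (Fin n) ℝ) (lam : ℝ) (hlam : 0 < lam),
      (LQG.gaussianTestChannel n m l SX SW hX hW H lam hlam).AdmitsDeterministicTeamOptimum) ∧
    (∀ (n K : ℕ) (μX : MeasureTheory.Measure (EuclideanSpace ℝ (Fin n)))
      (hμX : ProbabilityTheory.IsGaussian μX) (SW : Fin (K + 2) → Matrix (Fin n) (Fin n) ℝ)
      (hW : ∀ j, (SW j).PosDef) (lam : Fin (K + 1) → ℝ) (hlam : ∀ j, 0 < lam j),
      (LQG.gaussianRelayChannel n K μX hμX SW hW lam hlam).AdmitsDeterministicTeamOptimum) :=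
  ⟨fun _ _ _ P => P.admitsDeterministicTeamOptimum,
    fun _ _ _ _ _ _ _ => LQG.LQGTeam.admitsDeterministicTeamOptimum _,
    fun _ _ _ _ _ _ _ _ _ _ => LQG.LQGTeam.admitsDeterministicTeamOptimum _,
    fun _ _ _ _ _ _ _ _ => LQG.LQGTeam.admitsDeterministicTeamOptimum _⟩
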